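/- Let $d \ge 1$ be an integer, let $\Omega \subseteq \mathbb{R}^d$ be Lebesgue measurable, and let $H$ be a (possibly unbounded) selfadjoint operator in the complex Hilbert space $L_2(\Omega)$ such that $E_0 := \inf \sigma(H)$ is a real number (in particular $E_0 > -\infty$). Suppose that the $C_0$-semigroup $(e^{-tH})_{t\ge0}$ generated by $-H$ satisfies Gaussian upper bounds with constants $M \ge 1$, $\omega \in \mathbb{R}$, $a > 0$, i.e. for every $t>0$ the operator $e^{-tH}$ has an integral kernel $p_t$ and $$ |p_t(x,y)| \le M e^{\omega t} (a\pi t)^{-d/2} \exp\Bigl(-\frac{|x-y|^2}{at}\Bigr) \qquad \text{for a.e. } x,y\in\Omega . $$ Then, for all $t \ge 0$, $$ \|e^{-tH}\|_{\infty\to\infty} \le 2^{1/4} M \Bigl(1+\frac{5.56}{d}(E_0+\omega)t\Bigr)^{d/4} e^{-E_0 t}, $$ where $\|B\|_{\infty\to\infty} := \sup\{\|Bf\|_\infty : f \in L_2(\Omega)\cap L_\infty(\Omega),\ \|f\|_\infty \le 1\}$ for a bounded operator $B$ on $L_2(\Omega)$. -/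

import Mathlib

open MeasureTheory Filter Topology
open scoped ENNReal

namespace GaussianSemigroup

section Abstract

variable {X : Type*} [NormedAddCommGroup X] [NormedSpace ℂ X]

/-- The resolvent set of a (possibly unbounded) linear operator `H` in `X`: all `z` for which
`z - H : dom H → X` has an everywhere defined bounded two-sided inverse `R`. -/
def resolventSet (H : X →ₗ.[ℂ] X) : Set ℂ :=
  {z | ∃ R : X →L[ℂ] X,
    (∀ f : X, ∃ h : R f ∈ H.domain, z • R f - H ⟨R f, h⟩ = f) ∧
    (∀ f : H.domain, R (z • (f : X) - H f) = f)}

/-- The spectrum `σ(H)` of a (possibly unbounded) linear operator. -/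
def spectrum (H : X →ₗ.[ℂ] X) : Set ℂ := (resolventSet H)ᶜ

/-- `(T t)_{t ≥ 0}` is a `C₀`-semigroup of bounded operators on `X`
(the values `T t` for `t < 0` are irrelevant). -/
structure IsC0Semigroup (T : ℝ → X →L[ℂ] X) : Prop where
  map_zero : T 0 = ContinuousLinearMap.id ℂ X
  map_add : ∀ s t : ℝ, 0 ≤ s → 0 ≤ t → T (s + t) = (T s).comp (T t)
  tendsto_zero : ∀ f : X, Tendsto (fun t : ℝ => T t f) (𝓝[>] 0) (𝓝 f)

/-- `A` is the (infinitesimal) generator of `T`: `f ∈ dom A` with `A f = g` if and only if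
`(T t f - f) / t → g` as `t ↓ 0`. -/
def IsGenerator (A : X →ₗ.[ℂ] X) (T : ℝ → X →L[ℂ] X) : Prop :=
  ∀ f g : X, (f, g) ∈ A.graph ↔
    Tendsto (fun t : ℝ => ((t : ℂ)⁻¹) • (T t f - f)) (𝓝[>] 0) (𝓝 g)

/-- `T` is the `C₀`-semigroup `(e^{-tH})_{t ≥ 0}`, i.e. the `C₀`-semigroup generated by `-H`.
(A `C₀`-semigroup is uniquely determined on `[0, ∞)` by its generator.) -/
structure IsSemigroupGeneratedByNeg (H : X →ₗ.[ℂ] X) (T : ℝ → X →L[ℂ] X) : Prop where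
  isC0Semigroup : IsC0Semigroup T
  isGenerator : IsGenerator (-H) T

end Abstract

section Concrete

variable {d : ℕ}

/-- The complex Hilbert space `L₂(Ω)`, for `Ω ⊆ ℝ^d` with Lebesgue measure. -/
abbrev L2 (Ω : Set (EuclideanSpace ℝ (Fin d))) : Type :=
  Lp ℂ 2 (volume.restrict Ω)

variable {Ω : Set (EuclideanSpace ℝ (Fin d))}

/-- `p` is an integral kernel of the bounded operator `B` on `L₂(Ω)`: for all `f ∈ L₂(Ω)`,
`(B f)(x) = ∫_Ω p(x,y) f(y) dy` for a.e. `x ∈ Ω`, the integral being absolutely convergent. -/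
structure IsIntegralKernel (B : L2 Ω →L[ℂ] L2 Ω)
    (p : EuclideanSpace ℝ (Fin d) → EuclideanSpace ℝ (Fin d) → ℂ) : Prop where
  aestronglyMeasurable : AEStronglyMeasurable (Function.uncurry p)
    ((volume.restrict Ω).prod (volume.restrict Ω))
  integrable : ∀ f : L2 Ω, ∀ᵐ x ∂(volume.restrict Ω),
    Integrable (fun y => p x y * f y) (volume.restrict Ω)
  apply_eq : ∀ f : L2 Ω, ∀ᵐ x ∂(volume.restrict Ω),
    B f x = ∫ y, p x y * f y ∂(volume.restrict Ω)

/-- Gaussian upper bounds with constants `M ≥ 1`, `ω ∈ ℝ`, `a > 0`: for every `t > 0`, the operator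
`T t` has an integral kernel `p` such that
`|p(x,y)| ≤ M e^{ω t} (a π t)^{-d/2} exp(-|x-y|² / (a t))` for a.e. `x, y ∈ Ω`. -/
structure HasGaussianUpperBounds (T : ℝ → L2 Ω →L[ℂ] L2 Ω) (M ω a : ℝ) : Prop where
  one_le : 1 ≤ M
  pos : 0 < a
  exists_kernel : ∀ t : ℝ, 0 < t →
    ∃ p : EuclideanSpace ℝ (Fin d) → EuclideanSpace ℝ (Fin d) → ℂ,
      IsIntegralKernel (T t) p ∧
      ∀ᵐ z ∂((volume.restrict Ω).prod (volume.restrict Ω)),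
        ‖p z.1 z.2‖ ≤ M * Real.exp (ω * t) * (a * Real.pi * t) ^ (-((d : ℝ) / 2)) *
          Real.exp (-(‖z.1 - z.2‖ ^ 2 / (a * t)))

/-- The norm `‖B‖_{p→q} = sup {‖B f‖_q : f ∈ L_p ∩ L₂, ‖f‖_p ≤ 1}`, with values in `[0, ∞]`, of a
bounded operator `B` on `L₂(Ω)`. -/
noncomputable def normPQ (B : L2 Ω →L[ℂ] L2 Ω) (p q : ℝ≥0∞) : ℝ≥0∞ :=
  ⨆ (f : L2 Ω) (_ : eLpNorm f p (volume.restrict Ω) ≤ 1), eLpNorm (B f) q (volume.restrict Ω)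

end Concrete

end GaussianSemigroup

/-! The Gaussian bound carries the growth rate `ω`, while selfadjointness gives the better rate
`-E₀`, but only on L₂. The proof transfers the L₂ rate to Gaussian-weighted L₂ spaces and then to
L_∞.

Put S(z) = e^{-z(H - E₀)}, a holomorphic family of contractions on Re z > 0, and ρ = |· - x₀|. The
key claim is that e^{-ρ²/(aτ)} S(s) e^{ρ²/(a(s+τ))} is a contraction on L₂ for all s, τ > 0. Fix l =
τ/s and use ζ = 1/s as variable: both weights become exponentials of constant multiples of ζρ², so
the matrix element ⟨v, e^{-c₂ζρ²} S(1/ζ) e^{c₁ζρ²} u⟩ is holomorphic in ζ. As ζ approaches the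
imaginary axis the weights become unimodular and the bound tends to ‖v‖‖u‖. For large real ζ it is
bounded, because the Gaussian kernel estimate absorbs the weights exactly: the combined exponent is
minus a perfect square (`gaussian_exponent_eq`), and a Schur test applies. Cutting the weights off
to a ball gives growth of exponential type, so Phragmén-Lindelöf yields ‖v‖‖u‖ on the whole positive
axis; the constants `M`, `ω` and those of the Schur test disappear
(`norm_weighted_inner_le_of_holomorphic`). The cutoff is then removed by Fatou's lemma
(`lintegral_weighted_le_of_cutoff`).

For the L_∞ bound, write T(t) = T(s)T(t-s). At a point x₀, Cauchy-Schwarz with the weight centred at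
x₀ combines the kernel of T(s) with the weighted L₂ bound for T(t-s)f, where |f| ≤ 1. Optimising
over the weight gives the factor M e^{ωs} e^{-E₀(t-s)} ((1+√(t/s))²/4)^{d/4} (`normPQ_top_le`), and
a choice of θ = s/t gives the constant 5.56 (`exists_time_fraction`). The factor 2^{1/4} is not
needed for this argument and enters only through 1 ≤ 2^{1/4}. -/

namespace GaussianSemigroup

/-! ### Spectral mapping between an unbounded operator and its resolvent -/

section Resolvent

variable {X : Type*} [NormedAddCommGroup X] [NormedSpace ℂ X]

/-- `R` is the resolvent `(z - H)⁻¹`. -/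
structure IsResolvent (H : X →ₗ.[ℂ] X) (z : ℂ) (R : X →L[ℂ] X) : Prop where
  mem_domain : ∀ f : X, R f ∈ H.domain
  right_inv : ∀ (f : X) (h : R f ∈ H.domain), z • R f - H ⟨R f, h⟩ = f
  left_inv : ∀ f : H.domain, R (z • (f : X) - H f) = f

lemma mem_resolventSet_iff {H : X →ₗ.[ℂ] X} {z : ℂ} :
    z ∈ resolventSet H ↔ ∃ R, IsResolvent H z R := by
  constructor
  · rintro ⟨R, h1, h2⟩
    exact ⟨R, fun f => (h1 f).1, fun f h => (h1 f).2, h2⟩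
  · rintro ⟨R, h⟩
    exact ⟨R, fun f => ⟨h.mem_domain f, h.right_inv f _⟩, h.left_inv⟩

/-- With R = (z - H)⁻¹ one has ν - R = νR(z - ν⁻¹ - H) on the range of R, which suggests νR(ν - R)⁻¹
as the resolvent at z - ν⁻¹. This and its converse below let the spectral theory of bounded
operators be applied to H. -/
lemma IsResolvent.mem_resolventSet_of_isUnit {H : X →ₗ.[ℂ] X} {z : ℂ} {R : X →L[ℂ] X}
    (hR : IsResolvent H z R) {ν : ℂ} (hν : ν ≠ 0)
    (hu : IsUnit (algebraMap ℂ (X →L[ℂ] X) ν - R)) : z - ν⁻¹ ∈ resolventSet H := by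
  obtain ⟨u, hu⟩ := hu
  have hmul : ∀ f, ν • (↑u⁻¹ : X →L[ℂ] X) f - R ((↑u⁻¹ : X →L[ℂ] X) f) = f := fun f => by
    have := congrArg (fun A : X →L[ℂ] X => A f) u.mul_inv
    simpa [hu, Algebra.algebraMap_eq_smul_one] using this
  have hmul' : ∀ f, (↑u⁻¹ : X →L[ℂ] X) (ν • f - R f) = f := fun f => by
    have := congrArg (fun A : X →L[ℂ] X => A f) u.inv_mul
    simpa [hu, Algebra.algebraMap_eq_smul_one] using this
  refine mem_resolventSet_iff.2 ⟨ν • (R ∘L (↑u⁻¹ : X →L[ℂ] X)), ?_, ?_, ?_⟩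
  · intro f
    exact H.domain.smul_mem _ (hR.mem_domain _)
  · intro f h
    set g := (↑u⁻¹ : X →L[ℂ] X) f with hg
    have e : (⟨(ν • (R ∘L (↑u⁻¹ : X →L[ℂ] X))) f, h⟩ : H.domain) =
      ν • ⟨R g, hR.mem_domain g⟩ := rfl
    rw [e, H.map_smul]
    have h1 := hR.right_inv g (hR.mem_domain g)
    have h2 := hmul f
    rw [← hg] at h2
    have h3 : H ⟨R g, hR.mem_domain g⟩ = z • R g - g :=
      eq_sub_of_add_eq' (sub_eq_iff_eq_add.1 h1).symm
    rw [h3]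
    change (z - ν⁻¹) • (ν • R g) - ν • (z • R g - g) = f
    rw [← h2, sub_smul, smul_smul ν⁻¹, inv_mul_cancel₀ hν, smul_comm z ν]
    simp only [smul_sub, one_smul]
    abel
  · intro f
    change ν • R ((↑u⁻¹ : X →L[ℂ] X) ((z - ν⁻¹) • (f : X) - H f)) = f
    have h1 := hR.left_inv f
    have h2 : ν • ((z - ν⁻¹) • (f : X) - H f)
        = ν • (z • (f : X) - H f) - R (z • (f : X) - H f) := by
      rw [h1, sub_smul, smul_sub, smul_sub, smul_sub, smul_smul ν ν⁻¹, mul_inv_cancel₀ hν, one_smul]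
      abel
    rw [← map_smul, ← map_smul, h2, hmul', h1]

lemma IsResolvent.isUnit_of_mem_resolventSet {H : X →ₗ.[ℂ] X} {z : ℂ} {R : X →L[ℂ] X}
    (hR : IsResolvent H z R) {ν : ℂ} (hν : ν ≠ 0) (hz : z - ν⁻¹ ∈ resolventSet H) :
    IsUnit (algebraMap ℂ (X →L[ℂ] X) ν - R) := by
  obtain ⟨Q, hQ⟩ := mem_resolventSet_iff.1 hz
  -- Candidate inverse of ν - R, read off from the resolvent identity νR(ν - R)⁻¹ = Q.
  set V : X →L[ℂ] X := ν⁻¹ • (ContinuousLinearMap.id ℂ X + ν⁻¹ • Q) with hV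
  have hQ1 : ∀ g, z • Q g - H ⟨Q g, hQ.mem_domain g⟩ = g + ν⁻¹ • Q g := fun g => by
    have h := hQ.right_inv g (hQ.mem_domain g)
    rw [sub_smul] at h
    linear_combination (norm := module) h
  have hR1 : ∀ g, (z - ν⁻¹) • R g - H ⟨R g, hR.mem_domain g⟩ = g - ν⁻¹ • R g := fun g => by
    have h := hR.right_inv g (hR.mem_domain g)
    rw [sub_smul]
    linear_combination (norm := module) h
  have hRQ : ∀ g, R (g + ν⁻¹ • Q g) = Q g := fun g => by
    rw [← hQ1 g]; exact hR.left_inv ⟨Q g, hQ.mem_domain g⟩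
  have hQR : ∀ g, Q (g - ν⁻¹ • R g) = R g := fun g => by
    rw [← hR1 g]; exact hQ.left_inv ⟨R g, hR.mem_domain g⟩
  have h1 : (algebraMap ℂ (X →L[ℂ] X) ν - R) * V = 1 := by
    ext g
    have := hRQ g
    simp only [hV, Algebra.algebraMap_eq_smul_one, mul_apply_eq_comp,
      sub_apply, smul_apply,
      one_apply_eq_self, add_apply, ContinuousLinearMap.id_apply]
    rw [map_smul R, this, smul_smul, mul_inv_cancel₀ hν, one_smul]
    abel
  have h2 : V * (algebraMap ℂ (X →L[ℂ] X) ν - R) = 1 := by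
    ext g
    have := hQR g
    simp only [hV, Algebra.algebraMap_eq_smul_one, mul_apply_eq_comp,
      sub_apply, smul_apply,
      one_apply_eq_self, add_apply, ContinuousLinearMap.id_apply]
    have h3 : ν • g - R g = ν • (g - ν⁻¹ • R g) := by
      rw [smul_sub, smul_smul, mul_inv_cancel₀ hν, one_smul]
    rw [h3, map_smul, this, smul_smul ν⁻¹ ν, inv_mul_cancel₀ hν, one_smul, smul_add,
      smul_smul, inv_mul_cancel₀ hν, one_smul, sub_add_cancel]
  exact ⟨⟨_, V, h1, h2⟩, rfl⟩

end Resolvent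

/-! ### Lower bounds of a symmetric form versus the real spectrum -/

section SelfAdjoint

variable {X : Type*} [NormedAddCommGroup X] [InnerProductSpace ℂ X] [CompleteSpace X]

local notation "⟪" x ", " y "⟫" => inner ℂ x y

lemma inner_map_eq_of_isSelfAdjoint {H : X →ₗ.[ℂ] X} (hH : IsSelfAdjoint H) (f g : H.domain) :
    ⟪H f, (g : X)⟫ = ⟪(f : X), H g⟫ := by
  have h := H.adjoint_isFormalAdjoint hH.dense_domain
  rw [LinearPMap.isSelfAdjoint_def.1 hH] at h
  exact h f g

lemma IsResolvent.isSelfAdjoint {H : X →ₗ.[ℂ] X} (hH : IsSelfAdjoint H) {μ : ℝ} {R : X →L[ℂ] X}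
    (hR : IsResolvent H μ R) : IsSelfAdjoint R := by
  rw [ContinuousLinearMap.isSelfAdjoint_iff_isSymmetric]
  intro f g
  change ⟪R f, g⟫ = ⟪f, R g⟫
  have h1 := hR.right_inv g (hR.mem_domain g)
  have h2 := hR.right_inv f (hR.mem_domain f)
  conv_lhs => rw [← h1]
  conv_rhs => rw [← h2]
  rw [inner_sub_left, inner_sub_right, inner_smul_left, inner_smul_right,
    inner_map_eq_of_isSelfAdjoint hH ⟨R f, hR.mem_domain f⟩ ⟨R g, hR.mem_domain g⟩]
  simp

/-- A selfadjoint operator is bounded below by any real lower bound of its real spectrum. -/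
lemma lower_bound_of_resolventSet {H : X →ₗ.[ℂ] X} (hH : IsSelfAdjoint H) {E : ℝ}
    (hE : ∀ μ : ℝ, μ < E → (μ : ℂ) ∈ resolventSet H) (f : H.domain) :
    E * ‖(f : X)‖ ^ 2 ≤ (⟪H f, (f : X)⟫).re := by
  have key : ∀ μ : ℝ, μ < E → μ * ‖(f : X)‖ ^ 2 ≤ (⟪H f, (f : X)⟫).re := by
    intro μ hμ
    obtain ⟨R, hR⟩ := mem_resolventSet_iff.1 (hE μ hμ)
    have hsa := hR.isSelfAdjoint hH
    -- A negative x in σ(-R) would correspond to the point μ + 1/x of σ(H), which lies below μ,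
    -- hence below E. Positivity of -R tested on (μ - H)f is the form bound H ≥ μ at f; finally μ
    -- increases to E.
    have hneg : 0 ≤ -R := by
      rw [StarOrderedRing.nonneg_iff_spectrum_nonneg (R := ℝ) (-R) hsa.neg]
      intro x hx
      by_contra! hx0
      refine hx (spectrum.mem_resolventSet_iff.2 ?_)
      have h1 : ((-x : ℝ) : ℂ) ≠ 0 := by
        exact_mod_cast (neg_pos.2 hx0).ne'
      have h2 : (μ : ℂ) - ((-x : ℝ) : ℂ)⁻¹ ∈ resolventSet H := by
        have := hE (μ - (-x)⁻¹) (by have := inv_pos.2 (neg_pos.2 hx0); linarith)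
        push_cast at this ⊢
        exact this
      have h3 := (hR.isUnit_of_mem_resolventSet h1 h2).neg
      convert h3 using 1
      ext g
      simp [Algebra.algebraMap_eq_smul_one, add_comm]
    rw [ContinuousLinearMap.nonneg_iff_isPositive] at hneg
    have h4 := hneg.re_inner_nonneg_left ((μ : ℂ) • (f : X) - H f)
    have h5 := hR.left_inv f
    rw [neg_apply, h5, inner_neg_left, inner_sub_right, inner_smul_right,
      inner_self_eq_norm_sq_to_K, ← inner_map_eq_of_isSelfAdjoint hH f f] at h4
    simp only [map_neg, map_sub, RCLike.re_to_complex, Complex.re_ofReal_mul] at h4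
    have h6 : (((‖(f : X)‖ : ℂ) ^ 2)).re = ‖(f : X)‖ ^ 2 := by
      rw [← Complex.ofReal_pow, Complex.ofReal_re]
    have h7 := h4
    simp only [Complex.coe_algebraMap] at h7
    rw [h6] at h7
    linarith
  have hc : Tendsto (fun μ : ℝ => μ * ‖(f : X)‖ ^ 2) (𝓝[<] E) (𝓝 (E * ‖(f : X)‖ ^ 2)) :=
    ((continuous_id.mul continuous_const).tendsto E).mono_left nhdsWithin_le_nhds
  exact le_of_tendsto hc (by filter_upwards [self_mem_nhdsWithin] with μ hμ using key μ hμ)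

/-- If a symmetric operator is bounded below by `c` and has real points near `-∞` in its resolvent
set, then all real points below `c` belong to the resolvent set. -/
lemma mem_resolventSet_of_lower_bound {H : X →ₗ.[ℂ] X} {c : ℝ}
    (hc : ∀ f : H.domain, c * ‖(f : X)‖ ^ 2 ≤ (⟪H f, (f : X)⟫).re) {x μ : ℝ} (hx : x < c)
    (hμ : μ < x) (hμH : (μ : ℂ) ∈ resolventSet H) : (x : ℂ) ∈ resolventSet H := by
  obtain ⟨R, hR⟩ := mem_resolventSet_iff.1 hμH
  -- Cauchy-Schwarz applied to the form bound at Rg gives the resolvent estimate.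
  have hn : ‖R‖ ≤ (c - μ)⁻¹ := by
    refine R.opNorm_le_bound (inv_nonneg.2 (by linarith)) fun g => ?_
    have h1 := hc ⟨R g, hR.mem_domain g⟩
    have h2 := hR.right_inv g (hR.mem_domain g)
    have h3 : H ⟨R g, hR.mem_domain g⟩ = (μ : ℂ) • R g - g :=
      eq_sub_of_add_eq' (sub_eq_iff_eq_add.1 h2).symm
    rw [h3, inner_sub_left, inner_smul_left, inner_self_eq_norm_sq_to_K, Complex.sub_re,
      Complex.conj_ofReal, Complex.re_ofReal_mul] at h1
    have h6 : (((‖R g‖ : ℂ) ^ 2)).re = ‖R g‖ ^ 2 := by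
      rw [← Complex.ofReal_pow, Complex.ofReal_re]
    simp only [Complex.coe_algebraMap] at h1
    rw [h6] at h1
    have h7 : -(⟪g, R g⟫).re ≤ ‖g‖ * ‖R g‖ :=
      (neg_le_abs _).trans ((Complex.abs_re_le_norm _).trans (norm_inner_le_norm _ _))
    have h8 : (c - μ) * ‖R g‖ ^ 2 ≤ ‖g‖ * ‖R g‖ := by linarith
    rcases (norm_nonneg (R g)).eq_or_lt with h0 | h0
    · rw [← h0]; exact mul_nonneg (inv_nonneg.2 (by linarith)) (norm_nonneg _)
    · rw [inv_mul_eq_div, le_div_iff₀ (by linarith)]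
      nlinarith
  -- This ν solves μ - ν⁻¹ = x, and |ν| = 1/(x - μ) exceeds 1/(c - μ) ≥ ‖R‖, so ν lies outside the
  -- spectrum of R.
  have hν : ((-(x - μ)⁻¹ : ℝ) : ℂ) ≠ 0 := by
    exact_mod_cast neg_ne_zero.2 (inv_ne_zero (by linarith))
  have hu : IsUnit (algebraMap ℂ (X →L[ℂ] X) ((-(x - μ)⁻¹ : ℝ) : ℂ) - R) := by
    rcases subsingleton_or_nontrivial X with hX | hX
    · exact isUnit_of_subsingleton _
    · have : ((-(x - μ)⁻¹ : ℝ) : ℂ) ∈ _root_.resolventSet ℂ R := by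
        apply spectrum.mem_resolventSet_of_norm_lt
        rw [Complex.norm_real, norm_neg, Real.norm_of_nonneg (inv_nonneg.2 (by linarith))]
        exact hn.trans_lt (inv_strictAnti₀ (by linarith) (by linarith))
      exact this
  have := hR.mem_resolventSet_of_isUnit hν hu
  convert this using 1
  push_cast
  rw [inv_neg, inv_inv]
  ring

end SelfAdjoint

end GaussianSemigroup

namespace GaussianSemigroup

/-! ### Continuity and one-sided differentiability of semigroup orbits -/

section Orbits

variable {X : Type*} [NormedAddCommGroup X] [NormedSpace ℂ X]

/-- Evaluation of a locally bounded family of operators is jointly continuous. -/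
lemma tendsto_clm_apply {ι : Type*} {l : Filter ι} {A : ι → X →L[ℂ] X} {C : ℝ} {u : ι → X}
    {v w : X} (hC : ∀ᶠ i in l, ‖A i‖ ≤ C) (hA : Tendsto (fun i => A i v) l (𝓝 w))
    (hu : Tendsto u l (𝓝 v)) : Tendsto (fun i => A i (u i)) l (𝓝 w) := by
  have h0 : Tendsto (fun i => A i (u i - v)) l (𝓝 0) := by
    have h1 : Tendsto (fun i => C * ‖u i - v‖) l (𝓝 0) := by
      have := (tendsto_iff_norm_sub_tendsto_zero.1 hu).const_mul C
      simpa using this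
    refine squeeze_zero_norm' ?_ h1
    filter_upwards [hC] with i hi
    exact ((A i).le_opNorm _).trans (mul_le_mul_of_nonneg_right hi (norm_nonneg _))
  have := h0.add hA
  simpa using this

variable {T : ℝ → X →L[ℂ] X}

lemma IsC0Semigroup.apply_add (hT : IsC0Semigroup T) {s t : ℝ} (hs : 0 ≤ s) (ht : 0 ≤ t) (f : X) :
    T (s + t) f = T s (T t f) := by
  rw [hT.map_add s t hs ht]; rfl

lemma IsC0Semigroup.apply_comm (hT : IsC0Semigroup T) {s t : ℝ} (hs : 0 ≤ s) (ht : 0 ≤ t) (f : X) :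
    T s (T t f) = T t (T s f) := by
  rw [← hT.apply_add hs ht, ← hT.apply_add ht hs, add_comm]

lemma tendsto_sub_left_nhdsGT (s : ℝ) : Tendsto (fun r => r - s) (𝓝[>] s) (𝓝[>] 0) := by
  refine tendsto_nhdsWithin_iff.2 ⟨?_, ?_⟩
  · have : Tendsto (fun r => r - s) (𝓝 s) (𝓝 (s - s)) := tendsto_id.sub_const s
    rw [sub_self] at this
    exact this.mono_left nhdsWithin_le_nhds
  · filter_upwards [self_mem_nhdsWithin] with r hr using Set.mem_Ioi.2 (sub_pos.2 (Set.mem_Ioi.1 hr))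

lemma tendsto_sub_right_nhdsLT (s : ℝ) : Tendsto (fun r => s - r) (𝓝[<] s) (𝓝[>] 0) := by
  refine tendsto_nhdsWithin_iff.2 ⟨?_, ?_⟩
  · have : Tendsto (fun r => s - r) (𝓝 s) (𝓝 (s - s)) := tendsto_const_nhds.sub tendsto_id
    rw [sub_self] at this
    exact this.mono_left nhdsWithin_le_nhds
  · filter_upwards [self_mem_nhdsWithin] with r hr using Set.mem_Ioi.2 (sub_pos.2 (Set.mem_Iio.1 hr))

/-- Orbits of a locally bounded `C₀`-semigroup are continuous. -/
lemma IsC0Semigroup.continuousOn_apply (hT : IsC0Semigroup T)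
    (hb : ∀ b : ℝ, ∃ C : ℝ, ∀ t ∈ Set.Icc 0 b, ‖T t‖ ≤ C) (f : X) :
    ContinuousOn (fun t => T t f) (Set.Ici 0) := by
  intro s hs
  have hs : 0 ≤ s := hs
  have hr : Tendsto (fun r => T r f) (𝓝[>] s) (𝓝 (T s f)) := by
    have h1 := ((T s).continuous.tendsto f).comp
      ((hT.tendsto_zero f).comp (tendsto_sub_left_nhdsGT s))
    refine h1.congr' ?_
    filter_upwards [self_mem_nhdsWithin] with r hr
    have : s < r := hr
    simp only [Function.comp_apply]
    rw [← hT.apply_add hs (by linarith)]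
    congr 2; ring
  rcases hs.eq_or_lt with h0 | h0
  · subst h0
    change ContinuousWithinAt _ _ _
    rw [← Set.Ioi_insert, continuousWithinAt_insert_self]
    exact hr
  · refine ContinuousAt.continuousWithinAt (continuousAt_iff_continuous_left'_right'.2 ⟨?_, hr⟩)
    obtain ⟨C, hC⟩ := hb s
    have hev : ∀ᶠ r in 𝓝[<] s, r ∈ Set.Ioo 0 s := Ioo_mem_nhdsLT h0
    -- For left continuity, T(s)f - T(r)f = T(r)(T(s-r)f - f); the local bound controls the varying
    -- operator T(r).
    have h1 : Tendsto (fun r => T r (T (s - r) f - f)) (𝓝[<] s) (𝓝 0) := by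
      refine tendsto_clm_apply (C := C) (v := 0) ?_ ?_ ?_
      · filter_upwards [hev] with r hr using hC r ⟨hr.1.le, hr.2.le⟩
      · simp
      · have := ((hT.tendsto_zero f).comp (tendsto_sub_right_nhdsLT s)).sub_const f
        rwa [sub_self] at this
    have h2 : Tendsto (fun r => T s f - T r (T (s - r) f - f)) (𝓝[<] s) (𝓝 (T s f - 0)) :=
      tendsto_const_nhds.sub h1
    rw [sub_zero] at h2
    refine h2.congr' ?_
    filter_upwards [hev] with r hr
    rw [map_sub, ← hT.apply_add hr.1.le (by linarith [hr.2])]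
    simp

variable {H : X →ₗ.[ℂ] X}

lemma IsSemigroupGeneratedByNeg.tendsto (hT : IsSemigroupGeneratedByNeg H T) (f : H.domain) :
    Tendsto (fun t : ℝ => ((t : ℂ)⁻¹) • (T t f - f)) (𝓝[>] 0) (𝓝 (-H f)) :=
  (hT.isGenerator f (-H f)).1 ((-H).mem_graph ⟨f, f.2⟩)

/-- The bounded operator T(s) commutes with the difference quotients defining the generator, hence
with their limit. -/
lemma IsSemigroupGeneratedByNeg.exists_apply_eq (hT : IsSemigroupGeneratedByNeg H T) {s : ℝ}
    (hs : 0 ≤ s) (f : H.domain) : ∃ h : T s f ∈ H.domain, H ⟨T s f, h⟩ = T s (H f) := by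
  have h1 : (T s f, -T s (H f)) ∈ (-H).graph := by
    refine (hT.isGenerator _ _).2 ?_
    have := ((T s).continuous.tendsto _).comp (hT.tendsto f)
    rw [map_neg] at this
    refine this.congr' ?_
    filter_upwards [self_mem_nhdsWithin] with r hr
    simp only [Function.comp_apply, map_smul, map_sub]
    rw [hT.isC0Semigroup.apply_comm hs (le_of_lt hr)]
  obtain ⟨y, hy1, hy2⟩ := (LinearPMap.mem_graph_iff _).1 h1
  have hy1 : (y : X) = T s f := hy1
  have hd : T s f ∈ H.domain := hy1 ▸ y.2
  have hy : (⟨(y : X), y.2⟩ : H.domain) = ⟨T s f, hd⟩ := Subtype.ext hy1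
  refine ⟨hd, ?_⟩
  rw [← hy]
  have : (-H) y = -(H ⟨y, y.2⟩) := rfl
  rw [this] at hy2
  simpa using hy2

lemma IsSemigroupGeneratedByNeg.hasDerivWithinAt (hT : IsSemigroupGeneratedByNeg H T) {s : ℝ}
    (hs : 0 ≤ s) (f : H.domain) :
    HasDerivWithinAt (fun t => T t f) (-T s (H f)) (Set.Ici s) s := by
  rw [← hasDerivWithinAt_Ioi_iff_Ici, hasDerivWithinAt_iff_tendsto_slope' (by simp)]
  have := (((T s).continuous.tendsto _).comp (hT.tendsto f)).comp (tendsto_sub_left_nhdsGT s)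
  rw [map_neg] at this
  refine this.congr' ?_
  filter_upwards [self_mem_nhdsWithin] with r hr
  have hr : s < r := hr
  simp only [Function.comp_apply, map_smul, map_sub, slope_def_module]
  rw [← hT.isC0Semigroup.apply_add hs (by linarith), add_sub_cancel, ← Complex.ofReal_inv]
  rfl

/-- Right derivative of the time-reversed orbit. -/
lemma IsSemigroupGeneratedByNeg.hasDerivWithinAt_sub (hT : IsSemigroupGeneratedByNeg H T)
    (hb : ∀ b : ℝ, ∃ C : ℝ, ∀ t ∈ Set.Icc 0 b, ‖T t‖ ≤ C) {s t : ℝ}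
    (hs : 0 ≤ s) (hst : s < t) (f : H.domain) :
    HasDerivWithinAt (fun r => T (t - r) f) (T (t - s) (H f)) (Set.Ici s) s := by
  rw [← hasDerivWithinAt_Ioi_iff_Ici, hasDerivWithinAt_iff_tendsto_slope' (by simp)]
  obtain ⟨C, hC⟩ := hb t
  have hev : ∀ᶠ r in 𝓝[>] s, r ∈ Set.Ioo s t := Ioo_mem_nhdsGT hst
  have h1 : Tendsto (fun r => T (t - r) (-(((r - s : ℝ) : ℂ)⁻¹ • (T (r - s) f - f)))) (𝓝[>] s)
      (𝓝 (T (t - s) (H f))) := by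
    refine tendsto_clm_apply (C := C) (v := H f) ?_ ?_ ?_
    · filter_upwards [hev] with r hr using
        hC _ ⟨by linarith [hr.2], by linarith [hr.1]⟩
    · have hc := (hT.isC0Semigroup.continuousOn_apply hb (H f)) (t - s)
        (show (0 : ℝ) ≤ t - s by linarith)
      refine hc.tendsto.comp (tendsto_nhdsWithin_iff.2 ⟨?_, ?_⟩)
      · exact ((continuous_const.sub continuous_id).tendsto s).mono_left nhdsWithin_le_nhds
      · filter_upwards [hev] with r hr
        exact sub_nonneg.2 hr.2.le
    · have := ((hT.tendsto f).comp (tendsto_sub_left_nhdsGT s)).neg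
      rwa [neg_neg] at this
  refine h1.congr' ?_
  filter_upwards [hev] with r hr
  rw [slope_def_module, ← smul_neg, neg_sub, map_smul, map_sub,
    ← hT.isC0Semigroup.apply_add (by linarith [hr.2]) (by linarith [hr.1]), ← Complex.ofReal_inv]
  have : t - r + (r - s) = t - s := by ring
  rw [this]
  rfl

end Orbits

/-! ### Selfadjointness and norm bounds of the semigroup -/

section Hilbert

variable {X : Type*} [NormedAddCommGroup X] [InnerProductSpace ℂ X]
  {H : X →ₗ.[ℂ] X} {T : ℝ → X →L[ℂ] X}

local notation "⟪" x ", " y "⟫" => inner ℂ x y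

lemma IsSemigroupGeneratedByNeg.lower_bound (hT : IsSemigroupGeneratedByNeg H T) {ω : ℝ}
    (hb : ∀ t, 0 < t → ‖T t‖ ≤ Real.exp (ω * t)) (f : H.domain) :
    -ω * ‖(f : X)‖ ^ 2 ≤ (⟪H f, (f : X)⟫).re := by
  have h1 : Tendsto (fun t : ℝ => (⟪((t : ℂ)⁻¹) • (T t f - f), (f : X)⟫).re) (𝓝[>] 0)
      (𝓝 (⟪-H f, (f : X)⟫).re) :=
    (Complex.continuous_re.tendsto _).comp ((hT.tendsto f).inner tendsto_const_nhds)
  have h2 : Tendsto (fun t : ℝ => t⁻¹ * (Real.exp (ω * t) - 1) * ‖(f : X)‖ ^ 2) (𝓝[>] 0)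
      (𝓝 (ω * ‖(f : X)‖ ^ 2)) := by
    have h3 : HasDerivAt (fun t : ℝ => Real.exp (ω * t)) ω 0 := by
      have := ((hasDerivAt_id (0 : ℝ)).const_mul ω).exp
      simpa using this
    have h4 : Tendsto (fun t : ℝ => t⁻¹ • (Real.exp (ω * (0 + t)) - Real.exp (ω * 0))) (𝓝[>] 0)
        (𝓝 ω) := (hasDerivAt_iff_tendsto_slope_zero.1 h3).mono_left
      (nhdsWithin_mono 0 (fun x hx => (Set.mem_Ioi.1 hx).ne'))
    refine Tendsto.mul_const _ ?_
    simpa using h4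
  have h3 := le_of_tendsto_of_tendsto h1 h2 (by
    filter_upwards [self_mem_nhdsWithin] with t ht
    have ht : 0 < t := ht
    rw [inner_smul_left, inner_sub_left, inner_self_eq_norm_sq_to_K, map_inv₀, Complex.conj_ofReal,
      ← Complex.ofReal_inv, Complex.re_ofReal_mul, Complex.sub_re, mul_assoc]
    refine mul_le_mul_of_nonneg_left ?_ (inv_pos.2 ht).le
    have h5 : (⟪T t f, (f : X)⟫).re ≤ Real.exp (ω * t) * ‖(f : X)‖ ^ 2 := by
      refine (Complex.re_le_norm _).trans ((norm_inner_le_norm _ _).trans ?_)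
      rw [pow_two, ← mul_assoc]
      refine mul_le_mul_of_nonneg_right ?_ (norm_nonneg _)
      exact ((T t).le_opNorm _).trans (mul_le_mul_of_nonneg_right (hb t ht) (norm_nonneg _))
    have h6 : (((‖(f : X)‖ : ℂ) ^ 2)).re = ‖(f : X)‖ ^ 2 := by
      rw [← Complex.ofReal_pow, Complex.ofReal_re]
    simp only [Complex.coe_algebraMap]
    rw [h6]
    linarith)
  rw [inner_neg_left, Complex.neg_re] at h3
  linarith

variable [CompleteSpace X]

/-- The semigroup generated by `-H` with `H` selfadjoint consists of selfadjoint operators. -/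
lemma IsSemigroupGeneratedByNeg.isSelfAdjoint (hT : IsSemigroupGeneratedByNeg H T)
    (hH : IsSelfAdjoint H) (hb : ∀ b : ℝ, ∃ C : ℝ, ∀ t ∈ Set.Icc 0 b, ‖T t‖ ≤ C)
    {t : ℝ} (ht : 0 ≤ t) : IsSelfAdjoint (T t) := by
  have key : ∀ f g : H.domain, ⟪T t f, (g : X)⟫ = ⟪(f : X), T t g⟫ := by
    intro f g
    -- This function has zero right derivative by symmetry of H, so its values at s = 0 and s = t
    -- agree. Right derivatives with continuity are enough for constancy.
    have hcont : ContinuousOn (fun s => ⟪T (t - s) f, T s g⟫) (Set.Icc 0 t) := by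
      refine ContinuousOn.inner (𝕜 := ℂ) ?_ ?_
      · refine (hT.isC0Semigroup.continuousOn_apply hb (f : X)).comp
          (continuous_const.sub continuous_id).continuousOn ?_
        intro s hs
        exact sub_nonneg.2 hs.2
      · exact (hT.isC0Semigroup.continuousOn_apply hb (g : X)).mono fun s hs => hs.1
    have hder : ∀ s ∈ Set.Ico 0 t,
        HasDerivWithinAt (fun s => ⟪T (t - s) f, T s g⟫) 0 (Set.Ici s) s := by
      intro s hs
      have h1 := (hT.hasDerivWithinAt_sub hb hs.1 hs.2 f).inner ℂ (hT.hasDerivWithinAt hs.1 g)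
      obtain ⟨h2, h3⟩ := hT.exists_apply_eq (s := t - s) (by linarith [hs.2]) f
      obtain ⟨h4, h5⟩ := hT.exists_apply_eq hs.1 g
      have h6 := inner_map_eq_of_isSelfAdjoint hH ⟨T (t - s) f, h2⟩ ⟨T s g, h4⟩
      rw [← h3, ← h5, inner_neg_right, h6, neg_add_cancel] at h1
      exact h1
    have := constant_of_has_deriv_right_zero hcont hder t ⟨ht, le_rfl⟩
    simp only [sub_self, sub_zero, hT.isC0Semigroup.map_zero] at this
    exact this.symm
  rw [ContinuousLinearMap.isSelfAdjoint_iff_isSymmetric]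
  have hd := hH.dense_domain
  intro f g
  change ⟪T t f, g⟫ = ⟪f, T t g⟫
  refine (isClosed_eq (by fun_prop) (by fun_prop) :
    IsClosed {f | ⟪T t f, g⟫ = ⟪f, T t g⟫}).closure_subset_iff.2 (fun f hf => ?_) (hd f)
  refine (isClosed_eq (by fun_prop) (by fun_prop) :
    IsClosed {g | ⟪T t f, g⟫ = ⟪f, T t g⟫}).closure_subset_iff.2 (fun g hg => ?_) (hd g)
  exact key ⟨f, hf⟩ ⟨g, hg⟩

/-- Energy estimate: for f in the domain, e^{2Es}‖T(s)f‖² has nonpositive right derivative. Density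
extends the bound to all f. -/
lemma IsSemigroupGeneratedByNeg.norm_le (hT : IsSemigroupGeneratedByNeg H T)
    (hH : IsSelfAdjoint H) (hb : ∀ b : ℝ, ∃ C : ℝ, ∀ t ∈ Set.Icc 0 b, ‖T t‖ ≤ C)
    {E : ℝ} (hE : ∀ f : H.domain, E * ‖(f : X)‖ ^ 2 ≤ (⟪H f, (f : X)⟫).re)
    {t : ℝ} (ht : 0 ≤ t) : ‖T t‖ ≤ Real.exp (-(E * t)) := by
  have key : ∀ f : H.domain, ‖T t f‖ ≤ Real.exp (-(E * t)) * ‖(f : X)‖ := by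
    intro f
    have hc := (hT.isC0Semigroup.continuousOn_apply hb (f : X)).mono
      (fun s (hs : s ∈ Set.Icc 0 t) => hs.1)
    have hcont : ContinuousOn (fun s => Real.exp (2 * E * s) * (⟪T s f, T s f⟫).re)
        (Set.Icc 0 t) :=
      (by fun_prop : Continuous fun s => Real.exp (2 * E * s)).continuousOn.mul
        (Complex.continuous_re.comp_continuousOn (ContinuousOn.inner (𝕜 := ℂ) hc hc))
    have hder : ∀ s ∈ Set.Ico 0 t,
        HasDerivWithinAt (fun s => Real.exp (2 * E * s) * (⟪T s f, T s f⟫).re)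
          (2 * Real.exp (2 * E * s) * (E * ‖T s f‖ ^ 2 - (⟪T s (H f), T s f⟫).re)) (Set.Ici s) s := by
      intro s hs
      have h1 := (hT.hasDerivWithinAt hs.1 f).inner ℂ (hT.hasDerivWithinAt hs.1 f)
      have h2 : HasDerivWithinAt (fun s => Real.exp (2 * E * s))
          (Real.exp (2 * E * s) * (2 * E * 1)) (Set.Ici s) s :=
        (((hasDerivAt_id s).const_mul (2 * E)).exp).hasDerivWithinAt
      have h3 := h2.mul (Complex.reCLM.hasFDerivAt.comp_hasDerivWithinAt s h1)
      have e1 : (⟪T s f, T s f⟫).re = ‖T s f‖ ^ 2 := by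
        rw [inner_self_eq_norm_sq_to_K]
        exact_mod_cast Complex.ofReal_re _
      have e2 : (⟪T s f, T s (H f)⟫).re = (⟪T s (H f), T s f⟫).re := by
        rw [← inner_conj_symm, Complex.conj_re]
      refine h3.congr_deriv ?_
      simp only [Function.comp_apply, Complex.reCLM_apply, inner_neg_left, inner_neg_right,
        Complex.add_re, Complex.neg_re, e1, e2]
      ring
    have := image_le_of_deriv_right_le_deriv_boundary hcont hder
      (B := fun _ => (⟪(f : X), (f : X)⟫).re) (B' := fun _ => 0)
      (by simp [hT.isC0Semigroup.map_zero]) continuousOn_const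
      (fun s _ => hasDerivWithinAt_const _ _ _) (by
        intro s hs
        obtain ⟨h4, h5⟩ := hT.exists_apply_eq hs.1 f
        have := hE ⟨T s f, h4⟩
        rw [h5] at this
        exact mul_nonpos_of_nonneg_of_nonpos (by positivity) (by simpa using this))
      (⟨ht, le_rfl⟩ : t ∈ Set.Icc 0 t)
    have e1 : ∀ g : X, (⟪g, g⟫).re = ‖g‖ ^ 2 := fun g => by
      rw [inner_self_eq_norm_sq_to_K]
      exact_mod_cast Complex.ofReal_re _
    simp only [e1] at this
    have e2 : Real.exp (2 * E * t) = (Real.exp (E * t)) ^ 2 := by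
      rw [← Real.exp_nat_mul]; congr 1; push_cast; ring
    rw [e2, ← mul_pow] at this
    have := (sq_le_sq₀ (by positivity) (norm_nonneg _)).1 this
    rw [Real.exp_neg, inv_mul_eq_div, le_div_iff₀ (Real.exp_pos _)]
    linarith
  refine (T t).opNorm_le_bound (Real.exp_pos _).le fun f => ?_
  exact (isClosed_le (by fun_prop) (by fun_prop) :
    IsClosed {f | ‖T t f‖ ≤ Real.exp (-(E * t)) * ‖f‖}).closure_subset_iff.2
      (fun f hf => key ⟨f, hf⟩) (hH.dense_domain f)

/-- For selfadjoint semigroups, the constant in an exponential norm bound can be taken to be `1`. -/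
lemma IsC0Semigroup.norm_le_exp (hT : IsC0Semigroup T) (hsa : ∀ t, 0 ≤ t → IsSelfAdjoint (T t))
    {M ω : ℝ} (hM : 0 < M) (hb : ∀ t, 0 < t → ‖T t‖ ≤ M * Real.exp (ω * t)) {t : ℝ} (ht : 0 < t) :
    ‖T t‖ ≤ Real.exp (ω * t) := by
  have hpow : ∀ n : ℕ, T t ^ n = T (n * t) := by
    intro n
    induction n with
    | zero => simp [hT.map_zero]; rfl
    | succ n ih =>
      rw [pow_succ, ih]
      push_cast
      rw [add_mul, one_mul, hT.map_add _ _ (by positivity) ht.le]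
      rfl
  -- Selfadjointness gives ‖T(t)‖^(2ⁿ) = ‖T(2ⁿt)‖. Taking the 2ⁿ-th root leaves the rate intact and
  -- sends the constant to 1.
  have h1 : ∀ n : ℕ, ‖T t‖ ≤ M ^ (((2 : ℝ) ^ n)⁻¹) * Real.exp (ω * t) := by
    intro n
    have h2 := (hsa t ht.le).norm_pow_two_pow n
    rw [hpow] at h2
    have h3 := hb ((2 ^ n : ℕ) * t) (by positivity)
    rw [h2] at h3
    have h4 := Real.rpow_le_rpow (by positivity) h3 (inv_nonneg.2 (by positivity : (0 : ℝ) ≤ 2 ^ n))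
    rw [Real.mul_rpow hM.le (Real.exp_pos _).le, ← Real.exp_mul, ← Real.rpow_natCast,
      ← Real.rpow_mul (norm_nonneg _)] at h4
    push_cast at h4
    rw [mul_inv_cancel₀ (by positivity), Real.rpow_one] at h4
    have e : ω * (2 ^ n * t) * (2 ^ n)⁻¹ = ω * t := by
      field_simp
    rwa [e] at h4
  have h5 : Tendsto (fun n : ℕ => M ^ (((2 : ℝ) ^ n)⁻¹) * Real.exp (ω * t)) atTop
      (𝓝 (M ^ (0 : ℝ) * Real.exp (ω * t))) := by
    refine Tendsto.mul_const _ ?_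
    refine ((Real.continuous_const_rpow hM.ne').tendsto 0).comp ?_
    exact tendsto_inv_atTop_zero.comp (tendsto_pow_atTop_atTop_of_one_lt one_lt_two)
  rw [Real.rpow_zero, one_mul] at h5
  exact ge_of_tendsto' h5 h1

end Hilbert

end GaussianSemigroup

namespace GaussianSemigroup

/-! ### Complex powers of a positive operator and the holomorphic semigroup -/

section HolomorphicCalculus

/-- A continuous `C(K, ℂ)`-valued function is holomorphic if it is so pointwise on `K`. -/
lemma differentiableOn_continuousMap {K : Type*} [TopologicalSpace K] [CompactSpace K]
    {U : Set ℂ} (hU : IsOpen U) {F : ℂ → C(K, ℂ)} (hc : ContinuousOn F U)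
    (hd : ∀ x : K, DifferentiableOn ℂ (fun z => F z x) U) : DifferentiableOn ℂ F U := by
  intro c hcU
  obtain ⟨r, hr, hball⟩ := Metric.nhds_basis_closedBall.mem_iff.1 (hU.mem_nhds hcU)
  lift r to NNReal using hr.le
  have hr : 0 < r := by exact_mod_cast hr
  have hci : CircleIntegrable F c r :=
    (hc.mono (Metric.sphere_subset_closedBall.trans hball)).circleIntegrable r.2
  have hps := (hasFPowerSeriesOn_cauchy_integral hci hr).hasFPowerSeriesAt.differentiableAt
  refine (hps.congr_of_eventuallyEq ?_).differentiableWithinAt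
  filter_upwards [Metric.ball_mem_nhds c (by exact_mod_cast hr : (0 : ℝ) < r)] with w hw
  -- Evaluation at x commutes with the circle integral, so the scalar Cauchy formula identifies F
  -- near c with its vector-valued Cauchy integral, which is analytic.
  ext x
  have h1 := Complex.two_pi_I_inv_smul_circleIntegral_sub_inv_smul_of_differentiable_on_off_countable
    Set.countable_empty hw ((hd x).continuousOn.mono hball) (fun z hz =>
      (hd x).differentiableAt (hU.mem_nhds (hball (Metric.ball_subset_closedBall hz.1))))
  have hci' : CircleIntegrable (fun z => (z - w)⁻¹ • F z) c r := by
    have hinv : ContinuousOn (fun z => (z - w)⁻¹) (Metric.sphere c r) := by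
      refine ContinuousOn.inv₀ (by fun_prop) fun z hz h => ?_
      rw [sub_eq_zero] at h
      rw [h] at hz
      exact (Metric.mem_ball.1 hw).ne (Metric.mem_sphere.1 hz)
    have hs : ContinuousOn (fun z => (z - w)⁻¹ • F z) (Metric.sphere c r) :=
      hinv.smul (hc.mono (Metric.sphere_subset_closedBall.trans hball))
    exact hs.circleIntegrable r.2
  rw [← h1]
  have h2 : (∮ z in C(c, r), (z - w)⁻¹ • F z) x = ∮ z in C(c, r), ((z - w)⁻¹ • F z) x := by
    have h3 := (ContinuousMap.evalCLM ℂ x).intervalIntegral_comp_comm hci'.out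
    simp only [circleIntegral]
    exact h3.symm
  change _ = (2 * Real.pi * Complex.I : ℂ)⁻¹ • ((∮ z in C(c, r), (z - w)⁻¹ • F z) x)
  rw [h2]
  rfl

variable {X : Type*} [NormedAddCommGroup X] [InnerProductSpace ℂ X] [CompleteSpace X]

lemma exists_real_of_mem_spectrum {a : X →L[ℂ] X} (ha : 0 ≤ a) {x : ℂ}
    (hx : x ∈ _root_.spectrum ℂ a) : ∃ r : ℝ, 0 ≤ r ∧ r ≤ ‖a‖ ∧ (r : ℂ) = x := by
  have hsa : IsSelfAdjoint a := IsSelfAdjoint.of_nonneg ha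
  have h1 := hsa.mem_spectrum_eq_re hx
  refine ⟨x.re, ?_, ?_, h1.symm⟩
  · have h2 : x.re ∈ _root_.spectrum ℝ a := by
      rw [← spectrum.algebraMap_mem_iff ℂ, Complex.coe_algebraMap, ← h1]
      exact hx
    exact spectrum_nonneg_of_nonneg ha h2
  · rcases subsingleton_or_nontrivial X with hX | hX
    · have : Subsingleton (X →L[ℂ] X) := inferInstance
      exact absurd (isUnit_of_subsingleton _) hx
    · exact (Complex.re_le_norm x).trans (spectrum.norm_le_norm_of_mem hx)

/-- The spectrum may contain 0, where the power is still jointly continuous because Re z > 0. Thus a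
need not be injective. -/
lemma continuousOn_cpow_prod_spectrum {a : X →L[ℂ] X} (ha : 0 ≤ a) :
    ContinuousOn (fun p : ℂ × ℂ => p.1 ^ p.2) (_root_.spectrum ℂ a ×ˢ {z | 0 < z.re}) := by
  rintro ⟨x, z⟩ ⟨hx, hz⟩
  obtain ⟨r, hr, -, rfl⟩ := exists_real_of_mem_spectrum ha hx
  refine ContinuousAt.continuousWithinAt ?_
  rcases hr.eq_or_lt with h | h
  · rw [← h, Complex.ofReal_zero]
    exact Complex.continuousAt_cpow_zero_of_re_pos hz
  · exact continuousAt_cpow (Complex.ofReal_mem_slitPlane.2 h)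

lemma continuousOn_cpow_spectrum {a : X →L[ℂ] X} (ha : 0 ≤ a) {z : ℂ} (hz : 0 < z.re) :
    ContinuousOn (fun x : ℂ => x ^ z) (_root_.spectrum ℂ a) :=
  (continuousOn_cpow_prod_spectrum ha).comp (f := fun x => (x, z)) (by fun_prop)
    fun _ hx => ⟨hx, hz⟩

/-- The complex powers of a positive operator depend holomorphically on the exponent. -/
lemma differentiableOn_cfc_cpow {a : X →L[ℂ] X} (ha : 0 ≤ a) :
    DifferentiableOn ℂ (fun z : ℂ => cfc (fun x : ℂ => x ^ z) a) {z | 0 < z.re} := by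
  have hn : IsStarNormal a := (IsSelfAdjoint.of_nonneg ha).isStarNormal
  have hU : IsOpen {z : ℂ | 0 < z.re} := isOpen_lt continuous_const Complex.continuous_re
  classical
  set F : ℂ → C(_root_.spectrum ℂ a, ℂ) := fun z =>
    if h : 0 < z.re then ⟨fun x => (x : ℂ) ^ z, (continuousOn_cpow_spectrum ha h).domRestrict⟩ else 0
    with hF
  have hFx : ∀ z (_ : 0 < z.re) x, F z x = (x : ℂ) ^ z := fun z hz x => by
    simp only [hF, hz, dif_pos]; rfl
  have hFc : ContinuousOn F {z | 0 < z.re} := by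
    rw [continuousOn_iff_continuous_domRestrict]
    refine ContinuousMap.continuous_of_continuous_uncurry _ ?_
    have h1 : Continuous (fun p : {z : ℂ | 0 < z.re} × _root_.spectrum ℂ a =>
        (p.2 : ℂ) ^ (p.1 : ℂ)) :=
      (continuousOn_cpow_prod_spectrum ha).comp_continuous
        (f := fun p : {z : ℂ | 0 < z.re} × _root_.spectrum ℂ a => ((p.2 : ℂ), (p.1 : ℂ)))
        (by fun_prop) fun p => ⟨p.2.2, p.1.2⟩
    refine h1.congr fun p => ?_
    exact (hFx p.1 p.1.2 p.2).symm
  have hFd : DifferentiableOn ℂ F {z | 0 < z.re} := by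
    refine differentiableOn_continuousMap hU hFc fun x => ?_
    have : DifferentiableOn ℂ (fun z : ℂ => (x : ℂ) ^ z) {z | 0 < z.re} := by
      intro z hz
      refine (differentiableAt_id.const_cpow (Or.inr ?_)).differentiableWithinAt
      intro h
      have h : z = 0 := h
      rw [h] at hz
      exact lt_irrefl _ (show (0 : ℝ) < Complex.re 0 from hz)
    exact this.congr fun z hz => hFx z hz x
  let Φ : C(_root_.spectrum ℂ a, ℂ) →L[ℂ] (X →L[ℂ] X) :=
    ⟨(cfcHom (R := ℂ) hn).toAlgHom.toLinearMap, cfcHom_continuous hn⟩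
  refine (Φ.differentiable.comp_differentiableOn hFd).congr fun z hz => ?_
  change _ = cfcHom hn (F z)
  rw [cfc_apply _ a hn (continuousOn_cpow_spectrum ha hz)]
  congr 1
  ext x
  exact (hFx z hz x).symm

/-- A selfadjoint contraction semigroup extends to a bounded holomorphic semigroup on the open right
half-plane. -/
lemma exists_holomorphic_extension {B : ℝ → X →L[ℂ] X} (hB : IsC0Semigroup B)
    (hsa : ∀ t, 0 ≤ t → IsSelfAdjoint (B t)) (hn : ∀ t, 0 ≤ t → ‖B t‖ ≤ 1) :
    ∃ S : ℂ → X →L[ℂ] X, DifferentiableOn ℂ S {z | 0 < z.re} ∧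
      (∀ z : ℂ, 0 < z.re → ‖S z‖ ≤ 1) ∧ ∀ t : ℝ, 0 < t → S t = B t := by
  have hpos : ∀ t, 0 ≤ t → 0 ≤ B t := by
    intro t ht
    have h1 : B t = star (B (t / 2)) * B (t / 2) := by
      rw [(hsa (t / 2) (by linarith)).star_eq]
      have := hB.map_add (t / 2) (t / 2) (by linarith) (by linarith)
      rw [add_halves] at this
      exact this
    rw [h1]
    exact star_mul_self_nonneg _
  have hpow : ∀ (s : ℝ), 0 ≤ s → ∀ n : ℕ, B s ^ n = B (n * s) := by
    intro s hs n
    induction n with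
    | zero => simp [hB.map_zero]; rfl
    | succ n ih =>
      rw [pow_succ, ih]
      push_cast
      rw [add_mul, one_mul, hB.map_add _ _ (by positivity) hs]
      rfl
  have h1 := hpos 1 zero_le_one
  -- S(z) = B(1)^z. It agrees with B at a rational k/m because B(1) and B(k/m) are the m-th and k-th
  -- powers of B(1/m), and at every t > 0 by continuity.
  set S : ℂ → X →L[ℂ] X := fun z => cfc (fun x : ℂ => x ^ z) (B 1) with hS
  have hSd : DifferentiableOn ℂ S {z | 0 < z.re} := differentiableOn_cfc_cpow h1
  refine ⟨S, hSd, ?_, ?_⟩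
  · intro z hz
    refine norm_cfc_le zero_le_one fun x hx => ?_
    obtain ⟨r, hr0, hr1, rfl⟩ := exists_real_of_mem_spectrum h1 hx
    rcases hr0.eq_or_lt with h | h
    · rw [← h, Complex.ofReal_zero, Complex.zero_cpow (by rintro rfl; simp at hz)]
      simp
    · rw [Complex.norm_cpow_eq_rpow_re_of_pos h]
      exact Real.rpow_le_one hr0 (hr1.trans (hn 1 zero_le_one)) hz.le
  · have hrat : ∀ k m : ℕ, 0 < k → 0 < m → S ((k / m : ℝ) : ℂ) = B (k / m) := by
      intro k m hk hm
      have hm' : (m : ℂ) ≠ 0 := by exact_mod_cast hm.ne'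
      have hP := hpos (1 / m) (by positivity)
      have hPn : IsStarNormal (B (1 / m)) := (IsSelfAdjoint.of_nonneg hP).isStarNormal
      have e1 : B 1 = B (1 / m) ^ m := by
        rw [hpow _ (by positivity)]; congr 1; field_simp
      have e2 : B (k / m) = B (1 / m) ^ k := by
        rw [hpow _ (by positivity)]; congr 1; field_simp
      simp only [hS]
      have hre : 0 < (((k / m : ℝ) : ℂ)).re := by
        rw [Complex.ofReal_re]; positivity
      have hcont := continuousOn_cpow_spectrum h1 hre
      rw [e2, e1, ← cfc_comp_pow (fun x : ℂ => x ^ ((k / m : ℝ) : ℂ)) m (B (1 / m)) ?_ hPn,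
        ← cfc_pow_id (R := ℂ) (B (1 / m)) k hPn]
      · refine cfc_congr fun x hx => ?_
        obtain ⟨r, hr0, hr1, rfl⟩ := exists_real_of_mem_spectrum hP hx
        change ((r : ℂ) ^ m) ^ ((k / m : ℝ) : ℂ) = (r : ℂ) ^ k
        rw [← Complex.ofReal_pow, ← Complex.ofReal_cpow (by positivity), ← Complex.ofReal_pow,
          ← Real.rpow_natCast, ← Real.rpow_mul hr0, ← Real.rpow_natCast]
        congr 2
        field_simp
      · refine hcont.mono ?_
        rw [e1]
        rintro _ ⟨x, hx, rfl⟩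
        exact spectrum.pow_mem_pow (B (1 / m)) m hx
    intro t ht
    ext f
    have hc1 : ContinuousOn (fun t : ℝ => S t f) (Set.Ioi 0) := by
      have h2 : ContinuousOn (fun t : ℝ => S (t : ℂ)) (Set.Ioi 0) :=
        hSd.continuousOn.comp Complex.continuous_ofReal.continuousOn fun t ht => by
          simpa using ht
      exact h2.clm_apply continuousOn_const
    have hc2 : ContinuousOn (fun t : ℝ => B t f) (Set.Ioi 0) :=
      (hB.continuousOn_apply (fun b => ⟨1, fun t ht => hn t ht.1⟩) f).mono
        Set.Ioi_subset_Ici_self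
    have hsub : Set.Ioi (0 : ℝ) ⊆ closure (Set.Ioi (0 : ℝ) ∩ Set.range ((↑) : ℚ → ℝ)) :=
      Rat.denseRange_cast.open_subset_closure_inter isOpen_Ioi
    have heq : Set.EqOn (fun t : ℝ => S t f) (fun t : ℝ => B t f)
        (Set.Ioi (0 : ℝ) ∩ Set.range ((↑) : ℚ → ℝ)) := by
      rintro _ ⟨hq, q, rfl⟩
      have hq : 0 < q := by exact_mod_cast Set.mem_Ioi.1 hq
      have e : (q : ℝ) = (q.num.toNat : ℝ) / (q.den : ℝ) := by
        have h3 : ((q.num.toNat : ℤ)) = q.num := Int.toNat_of_nonneg (Rat.num_pos.2 hq).le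
        have h4 : ((q.num.toNat : ℝ)) = (q.num : ℝ) := by exact_mod_cast h3
        rw [h4]
        exact Rat.cast_def q
      have := hrat q.num.toNat q.den (by have := Rat.num_pos.2 hq; omega) q.den_pos
      simp only [e]
      rw [this]
    exact heq.of_subset_closure hc1 hc2 Set.inter_subset_left hsub ht

end HolomorphicCalculus

end GaussianSemigroup

namespace GaussianSemigroup

/-! ### Multiplication operators by cut-off Gaussian weights -/

section Multiplication

variable {α : Type*} [MeasurableSpace α] {μ : Measure α}

/-- Multiplication of `L₂`-functions by `L_∞`-functions. -/
noncomputable def mulL (μ : Measure α) : Lp ℂ ∞ μ →L[ℂ] Lp ℂ 2 μ →L[ℂ] Lp ℂ 2 μ :=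
  (ContinuousLinearMap.mul ℂ ℂ).holderL μ ∞ 2 2

lemma coeFn_mulL (φ : Lp ℂ ∞ μ) (f : Lp ℂ 2 μ) : mulL μ φ f =ᵐ[μ] fun x => φ x * f x :=
  (ContinuousLinearMap.mul ℂ ℂ).coeFn_holder φ f

lemma norm_mulL_le (φ : Lp ℂ ∞ μ) : ‖mulL μ φ‖ ≤ ‖φ‖ := by
  refine ContinuousLinearMap.opNorm_le_bound _ (norm_nonneg _) fun f => ?_
  refine ((ContinuousLinearMap.mul ℂ ℂ).norm_holder_apply_apply_le φ f).trans ?_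
  rw [mul_assoc]
  exact mul_le_of_le_one_left (by positivity) (ContinuousLinearMap.opNorm_mul_le ℂ ℂ)

lemma norm_Lp_top_le {φ : Lp ℂ ∞ μ} {C : ℝ} (hC : 0 ≤ C) (h : ∀ᵐ x ∂μ, ‖φ x‖ ≤ C) : ‖φ‖ ≤ C := by
  rw [Lp.norm_def, eLpNorm_exponent_top]
  exact ENNReal.toReal_le_of_le_ofReal hC (eLpNormEssSup_le_of_ae_bound h)

lemma lintegral_enorm_sq (f : Lp ℂ 2 μ) :
    ∫⁻ x, ‖f x‖ₑ ^ 2 ∂μ = ENNReal.ofReal (‖f‖ ^ 2) := by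
  have h := eLpNorm_nnreal_pow_eq_lintegral (f := f) (μ := μ) (p := 2) two_ne_zero
  have h2 : ENNReal.ofReal (‖f‖ ^ 2) = eLpNorm f 2 μ ^ 2 := by
    rw [Lp.norm_def, ← ENNReal.toReal_pow, ENNReal.ofReal_toReal]
    exact ENNReal.pow_ne_top (Lp.eLpNorm_ne_top f)
  rw [h2]
  have e : ((2 : NNReal) : ℝ≥0∞) = 2 := rfl
  rw [e] at h
  have e2 : (((2 : NNReal)) : ℝ) = ((2 : ℕ) : ℝ) := by norm_num
  simp only [e2, ENNReal.rpow_natCast] at h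
  exact h.symm

variable {E : Type*} [NormedAddCommGroup E]

/-- The Gaussian weight `x ↦ exp (w |x - x₀|²)`, cut off outside the ball of radius `R`. -/
noncomputable def cutoffGaussian (x₀ : E) (R : ℝ) (w : ℂ) : E → ℂ :=
  (Metric.ball x₀ R).indicator fun x => Complex.exp (w * ((‖x - x₀‖ ^ 2 : ℝ) : ℂ))

lemma norm_cutoffGaussian_le (x₀ : E) (R : ℝ) (w : ℂ) (x : E) :
    ‖cutoffGaussian x₀ R w x‖ ≤ Real.exp (max w.re 0 * R ^ 2) := by
  unfold cutoffGaussian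
  by_cases hx : x ∈ Metric.ball x₀ R
  · rw [Set.indicator_of_mem hx, Complex.norm_exp, Complex.re_mul_ofReal, Real.exp_le_exp]
    have h1 : ‖x - x₀‖ ^ 2 ≤ R ^ 2 :=
      pow_le_pow_left₀ (norm_nonneg _) (mem_ball_iff_norm.1 hx).le 2
    exact mul_le_mul (le_max_left _ _) h1 (sq_nonneg _) (le_max_right _ _)
  · rw [Set.indicator_of_notMem hx, norm_zero]
    exact (Real.exp_pos _).le

/-- The Taylor remainder is uniform in x because |x - x₀| < R on the support. This uniformity gives
differentiability in the L_∞ norm and is one reason for the cutoff. -/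
lemma norm_exp_mul_cutoff_sub_le (x₀ : E) (R : ℝ) (w h : ℂ) (hh : ‖h‖ * R ^ 2 ≤ 1) (x : E) :
    ‖cutoffGaussian x₀ R (w + h) x - cutoffGaussian x₀ R w x
      - h * (((‖x - x₀‖ ^ 2 : ℝ) : ℂ) * cutoffGaussian x₀ R w x)‖
      ≤ Real.exp (max w.re 0 * R ^ 2) * R ^ 4 * ‖h‖ ^ 2 := by
  have hw := norm_cutoffGaussian_le x₀ R w x
  by_cases hx : x ∈ Metric.ball x₀ R
  · have h1 : ‖x - x₀‖ ^ 2 ≤ R ^ 2 :=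
      pow_le_pow_left₀ (norm_nonneg _) (mem_ball_iff_norm.1 hx).le 2
    set q : ℂ := ((‖x - x₀‖ ^ 2 : ℝ) : ℂ) with hq
    have hqn : ‖q‖ = ‖x - x₀‖ ^ 2 := by
      rw [hq, Complex.norm_real, Real.norm_of_nonneg (sq_nonneg _)]
    have e : cutoffGaussian x₀ R (w + h) x - cutoffGaussian x₀ R w x
        - h * (q * cutoffGaussian x₀ R w x)
        = cutoffGaussian x₀ R w x * (Complex.exp (h * q) - 1 - h * q) := by
      simp only [cutoffGaussian, Set.indicator_of_mem hx]
      rw [add_mul, Complex.exp_add]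
      ring
    have hhq : ‖h * q‖ ≤ ‖h‖ * R ^ 2 := by
      rw [norm_mul, hqn]
      exact mul_le_mul_of_nonneg_left h1 (norm_nonneg _)
    rw [e, norm_mul]
    have h2 := Complex.norm_exp_sub_one_sub_id_le (hhq.trans hh)
    calc _ ≤ Real.exp (max w.re 0 * R ^ 2) * (‖h‖ * R ^ 2) ^ 2 := by
          gcongr
          exact h2.trans (pow_le_pow_left₀ (norm_nonneg _) hhq 2)
      _ = _ := by ring
  · simp only [cutoffGaussian, Set.indicator_of_notMem hx]
    simp only [sub_self, mul_zero, norm_zero]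
    positivity

variable [MeasurableSpace E] [BorelSpace E] {ν : Measure E}

lemma measurable_cutoffGaussian (x₀ : E) (R : ℝ) (w : ℂ) : Measurable (cutoffGaussian x₀ R w) := by
  refine Measurable.indicator (Continuous.measurable ?_) Metric.isOpen_ball.measurableSet
  fun_prop

lemma memLp_cutoffGaussian (x₀ : E) (R : ℝ) (w : ℂ) : MemLp (cutoffGaussian x₀ R w) ∞ ν :=
  memLp_top_of_bound (measurable_cutoffGaussian x₀ R w).aestronglyMeasurable _
    (Eventually.of_forall (norm_cutoffGaussian_le x₀ R w))

/-- `cutoffGaussian` as an element of `L_∞`. -/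
noncomputable def cutoffGaussianLp (ν : Measure E) (x₀ : E) (R : ℝ) (w : ℂ) : Lp ℂ ∞ ν :=
  (memLp_cutoffGaussian x₀ R w).toLp

lemma coeFn_cutoffGaussianLp (x₀ : E) (R : ℝ) (w : ℂ) :
    cutoffGaussianLp ν x₀ R w =ᵐ[ν] cutoffGaussian x₀ R w :=
  (memLp_cutoffGaussian x₀ R w).coeFn_toLp

lemma norm_cutoffGaussianLp_le (x₀ : E) (R : ℝ) (w : ℂ) :
    ‖cutoffGaussianLp ν x₀ R w‖ ≤ Real.exp (max w.re 0 * R ^ 2) := by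
  refine norm_Lp_top_le (Real.exp_pos _).le ?_
  filter_upwards [coeFn_cutoffGaussianLp (ν := ν) x₀ R w] with x hx
  rw [hx]
  exact norm_cutoffGaussian_le x₀ R w x

lemma differentiable_cutoffGaussianLp (x₀ : E) (R : ℝ) :
    Differentiable ℂ (cutoffGaussianLp ν x₀ R) := by
  intro w
  have hD : MemLp (fun x => ((‖x - x₀‖ ^ 2 : ℝ) : ℂ) * cutoffGaussian x₀ R w x) ∞ ν := by
    refine memLp_top_of_bound (C := R ^ 2 * Real.exp (max w.re 0 * R ^ 2)) ?_
      (Eventually.of_forall fun x => ?_)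
    · refine (Measurable.mul (Continuous.measurable ?_)
        (measurable_cutoffGaussian x₀ R w)).aestronglyMeasurable
      fun_prop
    · by_cases hx : x ∈ Metric.ball x₀ R
      · rw [norm_mul, Complex.norm_real, Real.norm_of_nonneg (sq_nonneg _)]
        exact mul_le_mul (pow_le_pow_left₀ (norm_nonneg _) (mem_ball_iff_norm.1 hx).le 2)
          (norm_cutoffGaussian_le x₀ R w x) (norm_nonneg _) (sq_nonneg _)
      · rw [cutoffGaussian, Set.indicator_of_notMem hx, mul_zero, norm_zero]
        positivity
  have : HasDerivAt (cutoffGaussianLp ν x₀ R) hD.toLp w := by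
    rw [hasDerivAt_iff_isLittleO_nhds_zero]
    have hO : (fun h : ℂ => cutoffGaussianLp ν x₀ R (w + h) - cutoffGaussianLp ν x₀ R w
        - h • hD.toLp) =O[𝓝 0] fun h : ℂ => ‖h‖ ^ 2 := by
      refine Asymptotics.IsBigO.of_bound (Real.exp (max w.re 0 * R ^ 2) * R ^ 4) ?_
      have hev : ∀ᶠ h : ℂ in 𝓝 0, ‖h‖ * R ^ 2 ≤ 1 := by
        have : Tendsto (fun h : ℂ => ‖h‖ * R ^ 2) (𝓝 0) (𝓝 0) := by
          have hc : Continuous (fun h : ℂ => ‖h‖ * R ^ 2) := by fun_prop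
          simpa using hc.tendsto 0
        exact (this.eventually_lt_const one_pos).mono fun _ h => h.le
      filter_upwards [hev] with h hh
      rw [Real.norm_of_nonneg (sq_nonneg _)]
      refine norm_Lp_top_le (by positivity) ?_
      filter_upwards [Lp.coeFn_sub (cutoffGaussianLp ν x₀ R (w + h) - cutoffGaussianLp ν x₀ R w)
          (h • hD.toLp), Lp.coeFn_sub (cutoffGaussianLp ν x₀ R (w + h)) (cutoffGaussianLp ν x₀ R w),
        Lp.coeFn_smul h hD.toLp, hD.coeFn_toLp, coeFn_cutoffGaussianLp (ν := ν) x₀ R w,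
        coeFn_cutoffGaussianLp (ν := ν) x₀ R (w + h)] with x h1 h2 h3 h4 h5 h6
      rw [h1, Pi.sub_apply, h2, Pi.sub_apply, h3, Pi.smul_apply, h4, h5, h6, smul_eq_mul]
      exact norm_exp_mul_cutoff_sub_le x₀ R w h hh x
    refine hO.trans_isLittleO ?_
    exact Asymptotics.isLittleO_norm_pow_id one_lt_two
  exact this.differentiableAt

end Multiplication

/-! ### Gaussian integrals and a Schur test -/

section Gaussian

variable {d : ℕ}

lemma lintegral_gaussian {b : ℝ} (hb : 0 < b) (c : EuclideanSpace ℝ (Fin d)) :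
    ∫⁻ y, ENNReal.ofReal (Real.exp (-b * ‖y - c‖ ^ 2)) =
      ENNReal.ofReal ((Real.pi / b) ^ ((d : ℝ) / 2)) := by
  rw [lintegral_sub_right_eq_self (fun y : EuclideanSpace ℝ (Fin d) => ENNReal.ofReal (Real.exp (-b * ‖y‖ ^ 2))) c]
  have h1 := GaussianFourier.integral_rexp_neg_mul_sq_norm (V := EuclideanSpace ℝ (Fin d)) hb
  have hint : Integrable (fun v : EuclideanSpace ℝ (Fin d) => Real.exp (-b * ‖v‖ ^ 2)) := by
    by_contra h
    rw [integral_undef h] at h1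
    have : 0 < (Real.pi / b) ^ ((Module.finrank ℝ (EuclideanSpace ℝ (Fin d)) : ℝ) / 2) := by positivity
    exact this.ne h1
  rw [← ofReal_integral_eq_lintegral_ofReal hint
    (Eventually.of_forall fun _ => (Real.exp_pos _).le), h1, finrank_euclideanSpace_fin]

lemma lintegral_gaussian_affine {β : ℝ} (hβ : 0 < β) (c x₀ : EuclideanSpace ℝ (Fin d)) :
    ∫⁻ y, ENNReal.ofReal (Real.exp (-‖c - β • (y - x₀)‖ ^ 2)) =
      ENNReal.ofReal ((Real.pi / β ^ 2) ^ ((d : ℝ) / 2)) := by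
  rw [← lintegral_gaussian (by positivity : 0 < β ^ 2) (x₀ + β⁻¹ • c)]
  congr 1
  ext y
  have : c - β • (y - x₀) = -(β • (y - (x₀ + β⁻¹ • c))) := by
    rw [sub_add_eq_sub_sub, smul_sub β (y - x₀), smul_smul, mul_inv_cancel₀ hβ.ne', one_smul]
    abel
  rw [this, norm_neg, norm_smul, Real.norm_of_nonneg hβ.le]
  congr 2
  ring

/-- The missing factor 1/2 is harmless: the Schur bounds built on this serve only as a priori
bounds, whose constants are later eliminated. -/
lemma ennreal_mul_le_sq_add_sq (a b : ℝ≥0∞) : a * b ≤ a ^ 2 + b ^ 2 := by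
  rcases le_total a b with h | h
  · calc a * b ≤ b * b := by gcongr
      _ = b ^ 2 := (pow_two b).symm
      _ ≤ _ := le_add_self
  · calc a * b ≤ a * a := by gcongr
      _ = a ^ 2 := (pow_two a).symm
      _ ≤ _ := le_self_add

variable {Ω : Set (EuclideanSpace ℝ (Fin d))}

/-- Schur test for weighted kernels dominated by a degenerate Gaussian. -/
lemma norm_inner_le_of_kernel_le {B : L2 Ω →L[ℂ] L2 Ω} {p : EuclideanSpace ℝ (Fin d) → EuclideanSpace ℝ (Fin d) → ℂ} (hp : IsIntegralKernel B p)
    {φ ψ : EuclideanSpace ℝ (Fin d) → ℝ} (hφ : ∀ y, 0 ≤ φ y) (hψ : ∀ x, 0 ≤ ψ x) {c α β : ℝ} (hc : 0 ≤ c) (hα : 0 < α)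
    (hβ : 0 < β) (x₀ : EuclideanSpace ℝ (Fin d))
    (hker : ∀ᵐ z ∂((volume.restrict Ω).prod (volume.restrict Ω)),
      ψ z.1 * ‖p z.1 z.2‖ * φ z.2 ≤
        c * Real.exp (-‖α • (z.1 - x₀) - β • (z.2 - x₀)‖ ^ 2))
    {u u' v w : L2 Ω} (hu : ∀ᵐ y ∂(volume.restrict Ω), ‖u' y‖ ≤ φ y * ‖u y‖)
    (hw : ∀ᵐ x ∂(volume.restrict Ω), ‖w x‖ ≤ ψ x * ‖B u' x‖) :
    ‖inner ℂ v w‖ ≤ c * ((Real.pi / β ^ 2) ^ ((d : ℝ) / 2) * ‖v‖ ^ 2 +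
      (Real.pi / α ^ 2) ^ ((d : ℝ) / 2) * ‖u‖ ^ 2) := by
  set μ : Measure (EuclideanSpace ℝ (Fin d)) := volume.restrict Ω with hμ
  set G : EuclideanSpace ℝ (Fin d) → EuclideanSpace ℝ (Fin d) → ℝ≥0∞ := fun x y =>
    ENNReal.ofReal (Real.exp (-‖α • (x - x₀) - β • (y - x₀)‖ ^ 2)) with hG
  have hGm : Measurable (Function.uncurry G) := by
    refine ENNReal.measurable_ofReal.comp (Continuous.measurable ?_)
    fun_prop
  have hGy : ∀ x, ∫⁻ y, G x y ∂μ ≤ ENNReal.ofReal ((Real.pi / β ^ 2) ^ ((d : ℝ) / 2)) := fun x => by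
    rw [← lintegral_gaussian_affine hβ (α • (x - x₀)) x₀]
    exact lintegral_mono' Measure.restrict_le_self le_rfl
  have hGx : ∀ y, ∫⁻ x, G x y ∂μ ≤ ENNReal.ofReal ((Real.pi / α ^ 2) ^ ((d : ℝ) / 2)) := fun y => by
    rw [← lintegral_gaussian_affine hα (β • (y - x₀)) x₀]
    refine lintegral_mono' Measure.restrict_le_self fun x => ?_
    simp only [hG]
    rw [norm_sub_rev]
  have hpt : ∀ᵐ x ∂μ, ‖inner ℂ (v x) (w x)‖ₑ ≤
      ENNReal.ofReal c * ∫⁻ y, G x y * (‖v x‖ₑ ^ 2 + ‖u y‖ₑ ^ 2) ∂μ := by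
    have hz : ∀ᵐ x ∂μ, ∀ᵐ y ∂μ, ψ x * ‖p x y‖ * φ y ≤
        c * Real.exp (-‖α • (x - x₀) - β • (y - x₀)‖ ^ 2) := Measure.ae_ae_of_ae_prod hker
    have hy := hp.apply_eq u'
    filter_upwards [hw, hy, hz] with x hx1 hx2 hx3
    have h1 : ‖w x‖ₑ ≤ ENNReal.ofReal (ψ x) * ∫⁻ y, ‖p x y‖ₑ * ‖u' y‖ₑ ∂μ := by
      calc ‖w x‖ₑ ≤ ENNReal.ofReal (ψ x) * ‖B u' x‖ₑ := by
            rw [← ofReal_norm, ← ofReal_norm, ← ENNReal.ofReal_mul (hψ x)]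
            exact ENNReal.ofReal_le_ofReal hx1
        _ ≤ _ := by
            gcongr
            rw [hx2]
            calc _ ≤ ∫⁻ y, ‖p x y * u' y‖ₑ ∂μ := enorm_integral_le_lintegral_enorm _
              _ = _ := lintegral_congr fun y => enorm_mul _ _
    have h2 : ‖inner ℂ (v x) (w x)‖ₑ ≤ ‖v x‖ₑ * ‖w x‖ₑ := by
      rw [← ofReal_norm, ← ofReal_norm, ← ofReal_norm, ← ENNReal.ofReal_mul (norm_nonneg _)]
      exact ENNReal.ofReal_le_ofReal (norm_inner_le_norm _ _)
    calc _ ≤ ‖v x‖ₑ * ‖w x‖ₑ := h2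
      _ ≤ ‖v x‖ₑ * (ENNReal.ofReal (ψ x) * ∫⁻ y, ‖p x y‖ₑ * ‖u' y‖ₑ ∂μ) := by gcongr
      _ = ∫⁻ y, ‖v x‖ₑ * ENNReal.ofReal (ψ x) * (‖p x y‖ₑ * ‖u' y‖ₑ) ∂μ := by
          rw [lintegral_const_mul' _ _ (by finiteness), mul_assoc]
      _ ≤ ∫⁻ y, ENNReal.ofReal c * (G x y * (‖v x‖ₑ ^ 2 + ‖u y‖ₑ ^ 2)) ∂μ := by
          refine lintegral_mono_ae ?_
          filter_upwards [hu, hx3] with y hy1 hy2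
          have h3 : ‖u' y‖ₑ ≤ ENNReal.ofReal (φ y) * ‖u y‖ₑ := by
            rw [← ofReal_norm, ← ofReal_norm, ← ENNReal.ofReal_mul (hφ y)]
            exact ENNReal.ofReal_le_ofReal hy1
          have h4 : ENNReal.ofReal (ψ x) * ‖p x y‖ₑ * ENNReal.ofReal (φ y) ≤
              ENNReal.ofReal c * G x y := by
            rw [← ofReal_norm, ← ENNReal.ofReal_mul (hψ x),
              ← ENNReal.ofReal_mul (mul_nonneg (hψ x) (norm_nonneg _)), ← ENNReal.ofReal_mul hc]
            exact ENNReal.ofReal_le_ofReal hy2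
          calc _ ≤ ‖v x‖ₑ * ENNReal.ofReal (ψ x) *
                (‖p x y‖ₑ * (ENNReal.ofReal (φ y) * ‖u y‖ₑ)) := by gcongr
            _ = (ENNReal.ofReal (ψ x) * ‖p x y‖ₑ * ENNReal.ofReal (φ y)) * (‖v x‖ₑ * ‖u y‖ₑ) := by
                ring
            _ ≤ (ENNReal.ofReal c * G x y) * (‖v x‖ₑ ^ 2 + ‖u y‖ₑ ^ 2) := by
                gcongr
                exact ennreal_mul_le_sq_add_sq _ _
            _ = _ := by ring
      _ = _ := lintegral_const_mul' _ _ ENNReal.ofReal_ne_top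
  have hvm : AEMeasurable (fun x => ‖v x‖ₑ ^ 2) μ := (Lp.aestronglyMeasurable v).enorm.pow_const 2
  have hum : AEMeasurable (fun x => ‖u x‖ₑ ^ 2) μ := (Lp.aestronglyMeasurable u).enorm.pow_const 2
  have hmain : ‖inner ℂ v w‖ₑ ≤ ENNReal.ofReal (c * ((Real.pi / β ^ 2) ^ ((d : ℝ) / 2) * ‖v‖ ^ 2 +
      (Real.pi / α ^ 2) ^ ((d : ℝ) / 2) * ‖u‖ ^ 2)) := by
    rw [L2.inner_def]
    calc _ ≤ ∫⁻ x, ‖inner ℂ (v x) (w x)‖ₑ ∂μ := enorm_integral_le_lintegral_enorm _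
      _ ≤ ∫⁻ x, ENNReal.ofReal c * ∫⁻ y, G x y * (‖v x‖ₑ ^ 2 + ‖u y‖ₑ ^ 2) ∂μ ∂μ :=
          lintegral_mono_ae hpt
      _ = ENNReal.ofReal c * ∫⁻ x, ∫⁻ y, G x y * (‖v x‖ₑ ^ 2 + ‖u y‖ₑ ^ 2) ∂μ ∂μ :=
          lintegral_const_mul' _ _ ENNReal.ofReal_ne_top
      _ = ENNReal.ofReal c * ((∫⁻ x, (∫⁻ y, G x y ∂μ) * ‖v x‖ₑ ^ 2 ∂μ) +
            ∫⁻ x, ∫⁻ y, G x y * ‖u y‖ₑ ^ 2 ∂μ ∂μ) := by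
          congr 1
          have hm : AEMeasurable (fun x => (∫⁻ y, G x y ∂μ) * ‖v x‖ₑ ^ 2) μ :=
            (hGm.lintegral_prod_right'.aemeasurable).mul hvm
          rw [← lintegral_add_left' hm]
          refine lintegral_congr fun x => ?_
          have hmx : Measurable (fun y => G x y * ‖v x‖ₑ ^ 2) :=
            (hGm.comp measurable_prodMk_left).mul_const _
          rw [← lintegral_mul_const' _ _ (by finiteness), ← lintegral_add_left hmx]
          simp only [mul_add]
      _ = ENNReal.ofReal c * ((∫⁻ x, (∫⁻ y, G x y ∂μ) * ‖v x‖ₑ ^ 2 ∂μ) +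
            ∫⁻ y, (∫⁻ x, G x y ∂μ) * ‖u y‖ₑ ^ 2 ∂μ) := by
          congr 2
          rw [lintegral_lintegral_swap]
          · refine lintegral_congr fun y => ?_
            rw [lintegral_mul_const' _ _ (by finiteness)]
          · exact hGm.aemeasurable.mul (hum.comp_snd)
      _ ≤ ENNReal.ofReal c * ((∫⁻ x, ENNReal.ofReal ((Real.pi / β ^ 2) ^ ((d : ℝ) / 2)) *
              ‖v x‖ₑ ^ 2 ∂μ) +
            ∫⁻ y, ENNReal.ofReal ((Real.pi / α ^ 2) ^ ((d : ℝ) / 2)) * ‖u y‖ₑ ^ 2 ∂μ) := by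
          gcongr with x y
          · exact hGy x
          · exact hGx y
      _ = _ := by
          rw [lintegral_const_mul' _ _ ENNReal.ofReal_ne_top,
            lintegral_const_mul' _ _ ENNReal.ofReal_ne_top, lintegral_enorm_sq, lintegral_enorm_sq,
            ← ENNReal.ofReal_mul (by positivity), ← ENNReal.ofReal_mul (by positivity),
            ← ENNReal.ofReal_add (by positivity) (by positivity), ← ENNReal.ofReal_mul hc]
  rw [← ofReal_norm] at hmain
  exact (ENNReal.ofReal_le_ofReal_iff (by positivity)).1 hmain

end Gaussian

end GaussianSemigroup

namespace GaussianSemigroup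

/-! ### Gaussian-weighted contractivity via Phragmén-Lindelöf -/

section WeightedEstimates

variable {d : ℕ} {Ω : Set (EuclideanSpace ℝ (Fin d))}

/-- The coefficients of ‖x‖² and ‖y‖² have product 1/b², so the quadratic form has zero
discriminant. With b = at and x₀ as origin, the weights are thus exactly as strong as the kernel can
absorb. -/
lemma gaussian_exponent_eq {V : Type*} [NormedAddCommGroup V] [InnerProductSpace ℝ V] {b l : ℝ}
    (hb : 0 < b) (hl : 0 < l) (x y : V) :
    -(‖x - y‖ ^ 2 / b) + ‖y‖ ^ 2 / (b * (1 + l)) - ‖x‖ ^ 2 / (b * l) =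
      -‖√((1 + l) / (l * b)) • x - √(l / ((1 + l) * b)) • y‖ ^ 2 := by
  have h1 : √((1 + l) / (l * b)) ^ 2 = (1 + l) / (l * b) := Real.sq_sqrt (by positivity)
  have h2 : √(l / ((1 + l) * b)) ^ 2 = l / ((1 + l) * b) := Real.sq_sqrt (by positivity)
  have h3 : √((1 + l) / (l * b)) * √(l / ((1 + l) * b)) = 1 / b := by
    rw [← Real.sqrt_mul (by positivity)]
    have : (1 + l) / (l * b) * (l / ((1 + l) * b)) = (1 / b) ^ 2 := by
      field_simp
    rw [this, Real.sqrt_sq (by positivity)]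
  rw [norm_sub_sq_real, norm_sub_sq_real, norm_smul, norm_smul, mul_pow, mul_pow, inner_smul_left,
    inner_smul_right, Real.norm_eq_abs, Real.norm_eq_abs, sq_abs, sq_abs, h1, h2]
  have h4 : (starRingEnd ℝ) √((1 + l) / (l * b)) * (√(l / ((1 + l) * b)) * inner ℝ x y) =
      1 / b * inner ℝ x y := by
    rw [← h3]; simp; ring
  rw [h4]
  field_simp
  ring

variable {T : ℝ → L2 Ω →L[ℂ] L2 Ω} {M ω a : ℝ}

lemma HasGaussianUpperBounds.norm_le (hG : HasGaussianUpperBounds T M ω a) {t : ℝ} (ht : 0 < t) :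
    ‖T t‖ ≤ 2 * M * Real.exp (ω * t) := by
  obtain ⟨p, hp, hpb⟩ := hG.exists_kernel t ht
  have ha := hG.pos
  have hM : 0 < M := one_pos.trans_le hG.one_le
  have hat : 0 < a * t := by positivity
  have hK : ∀ u v : L2 Ω, ‖inner ℂ v (T t u)‖ ≤ M * Real.exp (ω * t) * (‖v‖ ^ 2 + ‖u‖ ^ 2) := by
    intro u v
    have h := norm_inner_le_of_kernel_le hp (φ := fun _ => 1) (ψ := fun _ => 1)
      (fun _ => zero_le_one) (fun _ => zero_le_one)
      (c := M * Real.exp (ω * t) * (a * Real.pi * t) ^ (-((d : ℝ) / 2)))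
      (α := √(1 / (a * t))) (β := √(1 / (a * t))) (by positivity) (by positivity) (by positivity) 0
      (by
        filter_upwards [hpb] with z hz
        rw [one_mul, mul_one]
        refine hz.trans (le_of_eq ?_)
        rw [sub_zero, sub_zero, ← smul_sub, norm_smul, mul_pow, Real.norm_eq_abs, sq_abs,
          Real.sq_sqrt (by positivity)]
        congr 3
        ring)
      (u := u) (u' := u) (v := v) (w := T t u) (by simp) (by simp)
    refine h.trans (le_of_eq ?_)
    rw [Real.sq_sqrt (by positivity)]
    have e : Real.pi / (1 / (a * t)) = a * Real.pi * t := by field_simp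
    rw [e, ← mul_add, mul_assoc, ← mul_assoc ((a * Real.pi * t) ^ _), ← Real.rpow_add (by positivity),
      neg_add_cancel, Real.rpow_zero, one_mul]
  refine ContinuousLinearMap.opNorm_le_bound _ (by positivity) fun f => ?_
  rcases (norm_nonneg (T t f)).eq_or_lt with h0 | h0
  · rw [← h0]; positivity
  -- The test vector is rescaled to have the norm of f, which balances the two squares in `hK`.
  have h := hK f (((‖f‖ / ‖T t f‖ : ℝ) : ℂ) • T t f)
  rw [inner_smul_left, inner_self_eq_norm_sq_to_K, norm_mul, norm_smul, RCLike.norm_conj,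
    Complex.norm_real, norm_pow, Real.norm_of_nonneg (by positivity)] at h
  have e1 : ‖((‖T t f‖ : ℝ) : ℂ)‖ = ‖T t f‖ := by simp
  have e2 : ‖f‖ / ‖T t f‖ * ‖T t f‖ = ‖f‖ := by field_simp
  rw [e2] at h
  have h' : ‖f‖ / ‖T t f‖ * ‖T t f‖ ^ 2 ≤ M * Real.exp (ω * t) * (‖f‖ ^ 2 + ‖f‖ ^ 2) := by
    refine le_trans (le_of_eq ?_) h
    congr 2
    exact e1.symm
  rw [pow_two, ← mul_assoc, e2] at h'
  rcases (norm_nonneg f).eq_or_lt with h1 | h1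
  · have : f = 0 := norm_eq_zero.1 h1.symm
    simp [this]
  · have : ‖f‖ * ‖T t f‖ ≤ ‖f‖ * (2 * M * Real.exp (ω * t) * ‖f‖) := by
      refine h'.trans (le_of_eq ?_)
      ring
    exact le_of_mul_le_mul_left this h1

lemma norm_cutoffGaussian_ofReal {E : Type*} [NormedAddCommGroup E] (x₀ : E) (R r : ℝ) (x : E) :
    ‖cutoffGaussian x₀ R (r : ℂ) x‖ ≤ Real.exp (r * ‖x - x₀‖ ^ 2) := by
  unfold cutoffGaussian
  by_cases hx : x ∈ Metric.ball x₀ R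
  · rw [Set.indicator_of_mem hx, ← Complex.ofReal_mul, Complex.norm_exp, Complex.ofReal_re]
  · rw [Set.indicator_of_notMem hx, norm_zero]
    positivity

/-- The powers of t from the kernel prefactor and from the Gaussian integrals cancel. For fixed l,
only e^{ωt} depends on t, so the bound survives t → 0, as the real-axis hypothesis of
Phragmén-Lindelöf requires. -/
lemma HasGaussianUpperBounds.norm_weighted_inner_le (hG : HasGaussianUpperBounds T M ω a) {t l : ℝ}
    (ht : 0 < t) (hl : 0 < l) (x₀ : EuclideanSpace ℝ (Fin d)) (R : ℝ) (u v : L2 Ω) :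
    ‖inner ℂ v (mulL _ (cutoffGaussianLp _ x₀ R ((-(1 / (a * t * l)) : ℝ) : ℂ))
      (T t (mulL _ (cutoffGaussianLp _ x₀ R ((1 / (a * t * (1 + l)) : ℝ) : ℂ)) u)))‖ ≤
      M * Real.exp (ω * t) *
        (((1 + l) / l) ^ ((d : ℝ) / 2) * ‖v‖ ^ 2 + (l / (1 + l)) ^ ((d : ℝ) / 2) * ‖u‖ ^ 2) := by
  obtain ⟨p, hp, hpb⟩ := hG.exists_kernel t ht
  have ha := hG.pos
  have hM : 0 < M := one_pos.trans_le hG.one_le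
  have hat : 0 < a * t := by positivity
  have h := norm_inner_le_of_kernel_le hp
    (φ := fun y => Real.exp (1 / (a * t * (1 + l)) * ‖y - x₀‖ ^ 2))
    (ψ := fun y => Real.exp (-(1 / (a * t * l)) * ‖y - x₀‖ ^ 2))
    (fun _ => (Real.exp_pos _).le) (fun _ => (Real.exp_pos _).le)
    (c := M * Real.exp (ω * t) * (a * Real.pi * t) ^ (-((d : ℝ) / 2)))
    (α := √((1 + l) / (l * (a * t)))) (β := √(l / ((1 + l) * (a * t)))) (by positivity)
    (by positivity) (by positivity) x₀
    (by
      filter_upwards [hpb] with z hz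
      rw [← gaussian_exponent_eq hat hl]
      calc _ ≤ Real.exp (-(1 / (a * t * l)) * ‖z.1 - x₀‖ ^ 2) *
            (M * Real.exp (ω * t) * (a * Real.pi * t) ^ (-((d : ℝ) / 2)) *
              Real.exp (-(‖z.1 - z.2‖ ^ 2 / (a * t)))) *
            Real.exp (1 / (a * t * (1 + l)) * ‖z.2 - x₀‖ ^ 2) := by gcongr
        _ = M * Real.exp (ω * t) * (a * Real.pi * t) ^ (-((d : ℝ) / 2)) *
            (Real.exp (-(‖z.1 - z.2‖ ^ 2 / (a * t))) *
              Real.exp (1 / (a * t * (1 + l)) * ‖z.2 - x₀‖ ^ 2) *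
              Real.exp (-(1 / (a * t * l)) * ‖z.1 - x₀‖ ^ 2)) := by ring
        _ = _ := by
            rw [← Real.exp_add, ← Real.exp_add, sub_sub_sub_cancel_right]
            congr 2
            ring)
    (u := u) (v := v)
    (u' := mulL _ (cutoffGaussianLp _ x₀ R ((1 / (a * t * (1 + l)) : ℝ) : ℂ)) u)
    (w := mulL _ (cutoffGaussianLp _ x₀ R ((-(1 / (a * t * l)) : ℝ) : ℂ))
      (T t (mulL _ (cutoffGaussianLp _ x₀ R ((1 / (a * t * (1 + l)) : ℝ) : ℂ)) u)))
    (by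
      filter_upwards [coeFn_mulL (cutoffGaussianLp (volume.restrict Ω) x₀ R
        ((1 / (a * t * (1 + l)) : ℝ) : ℂ)) u, coeFn_cutoffGaussianLp (ν := volume.restrict Ω) x₀ R
        ((1 / (a * t * (1 + l)) : ℝ) : ℂ)] with y h1 h2
      rw [h1, h2, norm_mul]
      gcongr
      exact norm_cutoffGaussian_ofReal _ _ _ _)
    (by
      filter_upwards [coeFn_mulL (cutoffGaussianLp (volume.restrict Ω) x₀ R
        ((-(1 / (a * t * l)) : ℝ) : ℂ)) (T t (mulL _ (cutoffGaussianLp _ x₀ R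
        ((1 / (a * t * (1 + l)) : ℝ) : ℂ)) u)), coeFn_cutoffGaussianLp (ν := volume.restrict Ω) x₀ R
        ((-(1 / (a * t * l)) : ℝ) : ℂ)] with y h1 h2
      rw [h1, h2, norm_mul]
      gcongr
      exact norm_cutoffGaussian_ofReal _ _ _ _)
  refine h.trans (le_of_eq ?_)
  rw [Real.sq_sqrt (by positivity), Real.sq_sqrt (by positivity)]
  have e1 : Real.pi / (l / ((1 + l) * (a * t))) = a * Real.pi * t * ((1 + l) / l) := by field_simp
  have e2 : Real.pi / ((1 + l) / (l * (a * t))) = a * Real.pi * t * (l / (1 + l)) := by field_simp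
  rw [e1, e2]
  have hQ : 0 < a * Real.pi * t := by positivity
  generalize a * Real.pi * t = Q at hQ
  rw [Real.mul_rpow hQ.le (by positivity), Real.mul_rpow hQ.le (by positivity),
    mul_assoc (Q ^ ((d : ℝ) / 2)), mul_assoc (Q ^ ((d : ℝ) / 2)), ← mul_add,
    mul_assoc (M * Real.exp (ω * t)), ← mul_assoc (Q ^ _), ← Real.rpow_add hQ, neg_add_cancel,
    Real.rpow_zero, one_mul]

/-- A holomorphic function on the right half-plane that is bounded by `K` up to an exponential factor
vanishing on the imaginary axis, and is bounded near `+∞` on the real axis, is bounded by `K`. -/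
lemma norm_le_of_holomorphic_right_half_plane {F : ℂ → ℂ}
    (hFd : DifferentiableOn ℂ F {ζ | 0 < ζ.re}) {k K A B : ℝ} (hk : 0 ≤ k) (hK : 0 ≤ K)
    (hFb : ∀ ζ : ℂ, 0 < ζ.re → ‖F ζ‖ ≤ Real.exp (k * ζ.re) * K) (hA : 0 ≤ A)
    (hFr : ∀ r : ℝ, 0 < r → ‖F r‖ ≤ A * Real.exp (B * r⁻¹)) {r : ℝ} (hr : 0 < r) :
    ‖F r‖ ≤ K := by
  -- F is given only on the open half-plane, so the principle is applied to F(· + δ), which is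
  -- regular up to the boundary. The boundary bound then costs a factor e^{kδ}, which tends to 1.
  have hshift : ∀ δ : ℝ, 0 < δ → δ ≤ r →
      ‖F r‖ ≤ Real.exp (k * δ) * (K) := by
    intro δ hδ hδr
    have hmaps : Set.MapsTo (fun z : ℂ => z + (δ : ℂ)) {z | 0 ≤ z.re} {z | 0 < z.re} := by
      intro z hz
      have hz : 0 ≤ z.re := hz
      change 0 < (z + (δ : ℂ)).re
      rw [Complex.add_re, Complex.ofReal_re]
      linarith
    have hcl : closure {z : ℂ | 0 < z.re} = {z | 0 ≤ z.re} := Complex.closure_setOfPred_lt_re 0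
    have hd : DiffContOnCl ℂ (fun z => F (z + (δ : ℂ))) {z | 0 < z.re} := by
      refine DifferentiableOn.diffContOnCl ?_
      rw [hcl]
      exact hFd.comp (by fun_prop) hmaps
    have hres := PhragmenLindelof.right_half_plane_of_bounded_on_real (C :=
      Real.exp (k * δ) * (K)) (z := ((r - δ : ℝ) : ℂ)) hd ?_ ?_ ?_ ?_
    · simpa using hres
    -- Growth of order 1, below the critical order 2 of quarter-planes.
    · refine ⟨1, by norm_num, k, ?_⟩
      refine Asymptotics.IsBigO.of_bound (Real.exp (k * δ) * (K)) ?_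
      refine eventually_inf_principal.2 (Eventually.of_forall fun z hz => ?_)
      have hz : 0 < z.re := hz
      refine (hFb _ (hmaps hz.le)).trans ?_
      rw [Real.norm_of_nonneg (Real.exp_pos _).le, mul_right_comm, ← Real.exp_add, Real.rpow_one]
      gcongr
      rw [Complex.add_re, Complex.ofReal_re]
      have := Complex.re_le_norm z
      nlinarith
    · refine isBoundedUnder_of_eventually_le (a := A * Real.exp (|B| * δ⁻¹)) ?_
      filter_upwards [eventually_ge_atTop 0] with x hx
      rw [← Complex.ofReal_add]
      refine (hFr (x + δ) (by linarith)).trans ?_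
      have h5 : (x + δ)⁻¹ ≤ δ⁻¹ := inv_anti₀ hδ (by linarith)
      have h6 : 0 ≤ (x + δ)⁻¹ := inv_nonneg.2 (by linarith)
      gcongr
      exact le_abs_self B
    · intro y
      refine (hFb _ (hmaps (by simp))).trans (le_of_eq ?_)
      congr 2
      simp
    · simpa using hδr
  have hlim : Tendsto (fun δ : ℝ => Real.exp (k * δ) * (K)) (𝓝[>] 0)
      (𝓝 (K)) := by
    have hc : Continuous fun δ : ℝ => Real.exp (k * δ) * (K) := by fun_prop
    have := hc.tendsto 0
    simp only [mul_zero, Real.exp_zero, one_mul] at this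
    exact this.mono_left nhdsWithin_le_nhds
  exact ge_of_tendsto hlim (by
    filter_upwards [Ioc_mem_nhdsGT hr] with δ hδ using hshift δ hδ.1 hδ.2)

lemma norm_le_of_eq_ofReal_mul {e K : ℝ} {y z : ℂ} (he : 0 ≤ e) (h : z = (e : ℂ) * y)
    (hy : ‖y‖ ≤ K) : ‖z‖ ≤ e * K := by
  rw [h, norm_mul, Complex.norm_of_nonneg he]
  exact mul_le_mul_of_nonneg_left hy he

lemma inner_comp_smul_comp {X : Type*} [NormedAddCommGroup X] [InnerProductSpace ℂ X]
    (P B Q : X →L[ℂ] X) (c : ℂ) (u v : X) :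
    inner ℂ v (P ((c • B) (Q u))) = c * inner ℂ v (P (B (Q u))) := by
  rw [smul_apply, map_smul, inner_smul_right]

lemma inv_re_pos {ζ : ℂ} (hζ : 0 < ζ.re) : 0 < (ζ⁻¹).re := by
  rw [Complex.inv_re]
  exact div_pos hζ (Complex.normSq_pos.2 (by rintro rfl; simp at hζ))

/-- Phragmén-Lindelöf principle for a holomorphic semigroup with holomorphic weights. -/
lemma norm_inner_le_of_holomorphic_weights {X : Type*} [NormedAddCommGroup X]
    [InnerProductSpace ℂ X] {P Q S : ℂ → X →L[ℂ] X} (hP : Differentiable ℂ P)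
    (hQ : Differentiable ℂ Q) (hS : DifferentiableOn ℂ S {z | 0 < z.re})
    (hSn : ∀ z : ℂ, 0 < z.re → ‖S z‖ ≤ 1) (hPn : ∀ z : ℂ, 0 < z.re → ‖P z‖ ≤ 1) {k A B : ℝ}
    (hk : 0 ≤ k) (hA : 0 ≤ A) (hQn : ∀ z : ℂ, 0 < z.re → ‖Q z‖ ≤ Real.exp (k * z.re)) (u v : X)
    (hr : ∀ r : ℝ, 0 < r →
      ‖inner ℂ v (P r (S ((r⁻¹ : ℝ) : ℂ) (Q r u)))‖ ≤ A * Real.exp (B * r⁻¹)) {r : ℝ} (h0 : 0 < r) :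
    ‖inner ℂ v (P r (S ((r⁻¹ : ℝ) : ℂ) (Q r u)))‖ ≤ ‖v‖ * ‖u‖ := by
  set F : ℂ → ℂ := fun ζ => inner ℂ v (P ζ (S ζ⁻¹ (Q ζ u))) with hF
  have hFr : ∀ r : ℝ, F r = inner ℂ v (P r (S ((r⁻¹ : ℝ) : ℂ) (Q r u))) := fun r => by
    simp only [hF, Complex.ofReal_inv]
  have hFd : DifferentiableOn ℂ F {ζ | 0 < ζ.re} := by
    have h1 : DifferentiableOn ℂ (fun ζ : ℂ => S ζ⁻¹) {ζ | 0 < ζ.re} := by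
      refine hS.comp (t := {z : ℂ | 0 < z.re}) ?_ fun ζ hζ => inv_re_pos hζ
      refine DifferentiableOn.fun_inv differentiableOn_id fun ζ hζ h => ?_
      have h : ζ = 0 := h
      rw [h] at hζ
      exact lt_irrefl _ (show (0 : ℝ) < Complex.re 0 from hζ)
    have h2 : Differentiable ℂ (fun ζ : ℂ => Q ζ u) := hQ.clm_apply (differentiable_const u)
    have h4 := hP.differentiableOn.clm_apply (h1.clm_apply h2.differentiableOn)
    exact (innerSL ℂ v).differentiable.comp_differentiableOn h4
  have hFb : ∀ ζ : ℂ, 0 < ζ.re → ‖F ζ‖ ≤ Real.exp (k * ζ.re) * (‖v‖ * ‖u‖) := by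
    intro ζ hζ
    calc ‖F ζ‖ ≤ ‖v‖ * ‖P ζ (S ζ⁻¹ (Q ζ u))‖ := norm_inner_le_norm _ _
      _ ≤ ‖v‖ * (1 * (1 * (Real.exp (k * ζ.re) * ‖u‖))) := by
          gcongr
          refine (P ζ).le_of_opNorm_le_of_le (hPn ζ hζ) ?_
          refine (S ζ⁻¹).le_of_opNorm_le_of_le (hSn _ (inv_re_pos hζ)) ?_
          exact (Q ζ).le_of_opNorm_le (hQn ζ hζ) u
      _ = _ := by ring
  rw [← hFr]
  exact norm_le_of_holomorphic_right_half_plane hFd hk (by positivity) hFb hA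
    (fun r h => by rw [hFr]; exact hr r h) h0

/-- The weighted operators `e^{-ρ²/(aτ)} S(s) e^{ρ²/(a(s+τ))}` with `τ = l s` are contractions, where
`ρ = |· - x₀|` and the weights are cut off to a ball. -/
lemma norm_weighted_inner_le_of_holomorphic (hG : HasGaussianUpperBounds T M ω a)
    {S : ℂ → L2 Ω →L[ℂ] L2 Ω} {E : ℝ} (hSd : DifferentiableOn ℂ S {z | 0 < z.re})
    (hSn : ∀ z : ℂ, 0 < z.re → ‖S z‖ ≤ 1)
    (hST : ∀ t : ℝ, 0 < t → S t = ((Real.exp (E * t) : ℝ) : ℂ) • T t) {s l : ℝ}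
    (hs : 0 < s) (hl : 0 < l) (x₀ : EuclideanSpace ℝ (Fin d)) (R : ℝ) (u v : L2 Ω) :
    ‖inner ℂ v (mulL _ (cutoffGaussianLp _ x₀ R ((-(1 / (a * s * l)) : ℝ) : ℂ))
      (S s (mulL _ (cutoffGaussianLp _ x₀ R ((1 / (a * s * (1 + l)) : ℝ) : ℂ)) u)))‖ ≤
      ‖v‖ * ‖u‖ := by
  have ha := hG.pos
  have hM : 0 < M := one_pos.trans_le hG.one_le
  -- With l fixed, these constants do not depend on s: at ζ = 1/s the weight exponents are c₁ζ and
  -- -c₂ζ, which makes the weights entire in ζ.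
  obtain ⟨c₁, hc₁⟩ : ∃ c : ℝ, c = 1 / (a * (1 + l)) := ⟨_, rfl⟩
  obtain ⟨c₂, hc₂⟩ : ∃ c : ℝ, c = 1 / (a * l) := ⟨_, rfl⟩
  have hc₁0 : 0 < c₁ := by rw [hc₁]; positivity
  have hc₂0 : 0 < c₂ := by rw [hc₂]; positivity
  set W : ℂ → Lp ℂ ∞ (volume.restrict Ω) := cutoffGaussianLp (volume.restrict Ω) x₀ R with hW
  have hWd : Differentiable ℂ W := differentiable_cutoffGaussianLp x₀ R
  have hP : Differentiable ℂ (fun ζ : ℂ => mulL _ (W (-(c₂ : ℂ) * ζ))) :=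
    (mulL (volume.restrict Ω)).differentiable.comp
      (hWd.comp (differentiable_id.const_mul (-(c₂ : ℂ))))
  have hQ : Differentiable ℂ (fun ζ : ℂ => mulL _ (W ((c₁ : ℂ) * ζ))) :=
    (mulL (volume.restrict Ω)).differentiable.comp
      (hWd.comp (differentiable_id.const_mul (c₁ : ℂ)))
  have e1 : ∀ t : ℝ, 0 < t → -(c₂ : ℂ) * ((t⁻¹ : ℝ) : ℂ) = ((-(1 / (a * t * l)) : ℝ) : ℂ) := by
    intro t ht
    rw [← Complex.ofReal_neg, ← Complex.ofReal_mul]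
    congr 1
    rw [hc₂]; field_simp
  have e2 : ∀ t : ℝ, 0 < t → (c₁ : ℂ) * ((t⁻¹ : ℝ) : ℂ) = ((1 / (a * t * (1 + l)) : ℝ) : ℂ) := by
    intro t ht
    rw [← Complex.ofReal_mul]
    congr 1
    rw [hc₁]; field_simp
  have hmain := norm_inner_le_of_holomorphic_weights hP hQ hSd hSn (k := c₁ * R ^ 2)
    (A := M * (((1 + l) / l) ^ ((d : ℝ) / 2) * ‖v‖ ^ 2 + (l / (1 + l)) ^ ((d : ℝ) / 2) * ‖u‖ ^ 2))
    (B := E + ω) (fun ζ hζ => ?_) (by positivity) (by positivity) (fun ζ hζ => ?_) u v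
    (fun r hr => ?_) (inv_pos.2 hs)
  · simpa only [e1 s hs, e2 s hs, inv_inv] using hmain
  · refine (norm_mulL_le _).trans ((norm_cutoffGaussianLp_le _ _ _).trans ?_)
    rw [← Complex.ofReal_neg, Complex.re_ofReal_mul, max_eq_right (by nlinarith), zero_mul,
      Real.exp_zero]
  · refine (norm_mulL_le _).trans ((norm_cutoffGaussianLp_le _ _ _).trans ?_)
    rw [Complex.re_ofReal_mul, max_eq_left (by positivity), mul_right_comm]
  · have hr' := inv_pos.2 hr
    have h := hG.norm_weighted_inner_le hr' hl x₀ R u v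
    have e3 := e1 _ hr'
    have e4 := e2 _ hr'
    rw [inv_inv] at e3 e4
    refine (norm_le_of_eq_ofReal_mul (Real.exp_pos (E * r⁻¹)).le ?_ h).trans (le_of_eq ?_)
    · simp only [e3, e4, hST _ hr']
      exact inner_comp_smul_comp _ _ _ _ _ _
    · rw [add_mul, Real.exp_add]; ring

end WeightedEstimates

end GaussianSemigroup

namespace GaussianSemigroup

/-! ### Removing the cutoff from the weights -/

section RemovingCutoff

variable {E : Type*} [NormedAddCommGroup E]

lemma cutoffGaussian_mul (x₀ : E) (R : ℝ) (w z : ℂ) (x : E) :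
    cutoffGaussian x₀ R w x * cutoffGaussian x₀ R z x = cutoffGaussian x₀ R (w + z) x := by
  unfold cutoffGaussian
  by_cases hx : x ∈ Metric.ball x₀ R
  · simp only [Set.indicator_of_mem hx]
    rw [← Complex.exp_add, add_mul]
  · simp only [Set.indicator_of_notMem hx, mul_zero]

lemma enorm_cutoffGaussian_sq_le (x₀ : E) (R c : ℝ) (x : E) :
    ‖cutoffGaussian x₀ R (c : ℂ) x‖ₑ ^ 2 ≤ ENNReal.ofReal (Real.exp (2 * c * ‖x - x₀‖ ^ 2)) := by
  rw [← ofReal_norm, ← ENNReal.ofReal_pow (norm_nonneg _)]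
  refine ENNReal.ofReal_le_ofReal ?_
  refine (pow_le_pow_left₀ (norm_nonneg _) (norm_cutoffGaussian_ofReal x₀ R c x) 2).trans
    (le_of_eq ?_)
  rw [← Real.exp_nat_mul]
  congr 1
  push_cast
  ring

lemma enorm_cutoffGaussian_sq_eq {x₀ x : E} {R : ℝ} (hx : x ∈ Metric.ball x₀ R) (c : ℝ) :
    ‖cutoffGaussian x₀ R (c : ℂ) x‖ₑ ^ 2 = ENNReal.ofReal (Real.exp (2 * c * ‖x - x₀‖ ^ 2)) := by
  rw [← ofReal_norm, ← ENNReal.ofReal_pow (norm_nonneg _), cutoffGaussian,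
    Set.indicator_of_mem hx, ← Complex.ofReal_mul, Complex.norm_exp, Complex.ofReal_re,
    ← Real.exp_nat_mul]
  congr 2
  push_cast
  ring

lemma eventually_mem_ball_natCast (x₀ x : E) : ∀ᶠ n : ℕ in atTop, x ∈ Metric.ball x₀ (n : ℝ) := by
  obtain ⟨N, hN⟩ := exists_nat_gt (dist x x₀)
  filter_upwards [eventually_ge_atTop N] with n hn
  exact Metric.mem_ball.2 (hN.trans_le (by exact_mod_cast hn))

variable [MeasurableSpace E] [BorelSpace E] {ν : Measure E}

lemma coeFn_mulL_cutoffGaussianLp (x₀ : E) (R : ℝ) (w : ℂ) (f : Lp ℂ 2 ν) :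
    mulL ν (cutoffGaussianLp ν x₀ R w) f =ᵐ[ν] fun x => cutoffGaussian x₀ R w x * f x := by
  filter_upwards [coeFn_mulL (cutoffGaussianLp ν x₀ R w) f, coeFn_cutoffGaussianLp (ν := ν) x₀ R w]
    with x h1 h2
  rw [h1, h2]

lemma mulL_cutoffGaussianLp_mulL (x₀ : E) (R : ℝ) (w z : ℂ) (f : Lp ℂ 2 ν) :
    mulL ν (cutoffGaussianLp ν x₀ R w) (mulL ν (cutoffGaussianLp ν x₀ R z) f) =
      mulL ν (cutoffGaussianLp ν x₀ R (w + z)) f := by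
  refine Lp.ext ?_
  filter_upwards [coeFn_mulL_cutoffGaussianLp x₀ R w (mulL ν (cutoffGaussianLp ν x₀ R z) f),
    coeFn_mulL_cutoffGaussianLp x₀ R z f, coeFn_mulL_cutoffGaussianLp x₀ R (w + z) f] with x h1 h2 h3
  rw [h1, h2, h3, ← mul_assoc, cutoffGaussian_mul]

lemma tendsto_norm_sub_mulL_cutoff (x₀ : E) (f : Lp ℂ 2 ν) :
    Tendsto (fun n : ℕ => ‖f - mulL ν (cutoffGaussianLp ν x₀ n 0) f‖) atTop (𝓝 0) := by
  have h1 : Tendsto (fun n : ℕ => ∫⁻ x, ‖(f - mulL ν (cutoffGaussianLp ν x₀ n 0) f : Lp ℂ 2 ν) x‖ₑ ^ 2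
      ∂ν) atTop (𝓝 (∫⁻ _, 0 ∂ν)) := by
    have hpt : ∀ n : ℕ, ∀ᵐ x ∂ν, (f - mulL ν (cutoffGaussianLp ν x₀ n 0) f : Lp ℂ 2 ν) x =
        f x - cutoffGaussian x₀ n 0 x * f x := fun n => by
      filter_upwards [Lp.coeFn_sub f (mulL ν (cutoffGaussianLp ν x₀ n 0) f),
        coeFn_mulL_cutoffGaussianLp x₀ n 0 f] with x h1 h2
      rw [h1, Pi.sub_apply, h2]
    refine tendsto_lintegral_of_dominated_convergence' (fun x => ‖f x‖ₑ ^ 2)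
      (fun n => (Lp.aestronglyMeasurable _).enorm.pow_const 2) (fun n => ?_) ?_ ?_
    · filter_upwards [hpt n] with x hx
      rw [hx]
      gcongr
      by_cases hb : x ∈ Metric.ball x₀ (n : ℝ)
      · simp [cutoffGaussian, Set.indicator_of_mem hb]
      · simp [cutoffGaussian, Set.indicator_of_notMem hb]
    · rw [lintegral_enorm_sq]
      exact ENNReal.ofReal_ne_top
    · filter_upwards [ae_all_iff.2 hpt] with x hx
      refine tendsto_const_nhds.congr' ?_
      filter_upwards [eventually_mem_ball_natCast x₀ x] with n hn
      rw [hx n]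
      simp [cutoffGaussian, Set.indicator_of_mem hn]
  rw [lintegral_zero] at h1
  simp only [lintegral_enorm_sq] at h1
  have h2 := (ENNReal.tendsto_toReal ENNReal.zero_ne_top).comp h1
  simp only [Function.comp_def, ENNReal.toReal_zero] at h2
  have h3 := h2.sqrt
  rw [Real.sqrt_zero] at h3
  refine h3.congr fun n => ?_
  rw [ENNReal.toReal_ofReal (sq_nonneg _), Real.sqrt_sq (norm_nonneg _)]

/-- Weighted `L₂`-contractivity with cut-off weights implies the same with Gaussian weights. -/
lemma lintegral_weighted_le_of_cutoff {S : Lp ℂ 2 ν →L[ℂ] Lp ℂ 2 ν} (hS : ‖S‖ ≤ 1) {c₁ c₂ : ℝ}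
    (hc₁ : 0 ≤ c₁) (hc₂ : 0 ≤ c₂) (x₀ : E)
    (h : ∀ (R : ℝ) (u : Lp ℂ 2 ν), ‖mulL ν (cutoffGaussianLp ν x₀ R ((-c₂ : ℝ) : ℂ))
      (S (mulL ν (cutoffGaussianLp ν x₀ R ((c₁ : ℝ) : ℂ)) u))‖ ≤ ‖u‖) (f : Lp ℂ 2 ν) :
    ∫⁻ x, ENNReal.ofReal (Real.exp (2 * -c₂ * ‖x - x₀‖ ^ 2)) * ‖S f x‖ₑ ^ 2 ∂ν ≤
      ∫⁻ x, ENNReal.ofReal (Real.exp (2 * -c₁ * ‖x - x₀‖ ^ 2)) * ‖f x‖ₑ ^ 2 ∂ν := by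
  set A : ℝ≥0∞ := ∫⁻ x, ENNReal.ofReal (Real.exp (2 * -c₁ * ‖x - x₀‖ ^ 2)) * ‖f x‖ₑ ^ 2 ∂ν with hA
  have hsq : ∀ (R c : ℝ) (g : Lp ℂ 2 ν),
      ENNReal.ofReal (‖mulL ν (cutoffGaussianLp ν x₀ R (c : ℂ)) g‖ ^ 2) =
        ∫⁻ x, ‖cutoffGaussian x₀ R (c : ℂ) x‖ₑ ^ 2 * ‖g x‖ₑ ^ 2 ∂ν := fun R c g => by
    rw [← lintegral_enorm_sq]
    refine lintegral_congr_ae ?_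
    filter_upwards [coeFn_mulL_cutoffGaussianLp x₀ R (c : ℂ) g] with x hx
    rw [hx, enorm_mul, mul_pow]
  have hAtop : A ≠ ∞ := by
    have : A ≤ ∫⁻ x, ‖f x‖ₑ ^ 2 ∂ν := by
      refine lintegral_mono fun x => mul_le_of_le_one_left' ?_
      rw [ENNReal.ofReal_le_one, Real.exp_le_one_iff]
      nlinarith [sq_nonneg ‖x - x₀‖, mul_nonneg hc₁ (sq_nonneg ‖x - x₀‖)]
    refine (this.trans_lt ?_).ne
    rw [lintegral_enorm_sq]
    exact ENNReal.ofReal_lt_top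
  have h1 : ∀ n : ℕ, ‖mulL ν (cutoffGaussianLp ν x₀ n ((-c₁ : ℝ) : ℂ)) f‖ ≤ √A.toReal := by
    intro n
    refine Real.le_sqrt_of_sq_le ((ENNReal.ofReal_le_iff_le_toReal hAtop).1 ?_)
    rw [hsq]
    refine lintegral_mono fun x => ?_
    gcongr
    exact enorm_cutoffGaussian_sq_le x₀ n (-c₁) x
  have h2 : ∀ n : ℕ, ‖mulL ν (cutoffGaussianLp ν x₀ n ((-c₂ : ℝ) : ℂ)) (S f)‖ ≤
      √A.toReal + ‖f - mulL ν (cutoffGaussianLp ν x₀ n 0) f‖ := by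
    intro n
    set P := mulL ν (cutoffGaussianLp ν x₀ n ((-c₂ : ℝ) : ℂ)) with hP
    set fn := mulL ν (cutoffGaussianLp ν x₀ n 0) f with hfn
    have hP1 : ‖P‖ ≤ 1 := by
      refine (norm_mulL_le _).trans ((norm_cutoffGaussianLp_le _ _ _).trans ?_)
      rw [Complex.ofReal_re, max_eq_right (by linarith), zero_mul, Real.exp_zero]
    -- The cut-off function fn equals the weight with exponent c₁ times the weight with exponent -c₁
    -- applied to f, so the hypothesis applies to it. The remainder vanishes in the limit, and
    -- Fatou's lemma concludes.
    have e : P (S f) = P (S fn) + P (S (f - fn)) := by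
      rw [← map_add, ← map_add]; congr 2; abel
    rw [e]
    refine (norm_add_le _ _).trans (add_le_add ?_ ?_)
    · have h3 := h n (mulL ν (cutoffGaussianLp ν x₀ n ((-c₁ : ℝ) : ℂ)) f)
      rw [mulL_cutoffGaussianLp_mulL, ← Complex.ofReal_add, add_neg_cancel, Complex.ofReal_zero] at h3
      exact h3.trans (h1 n)
    · refine (P.le_of_opNorm_le_of_le hP1 (S.le_of_opNorm_le hS (f - fn))).trans (le_of_eq ?_)
      rw [one_mul, one_mul]
  have hlim : Tendsto (fun n : ℕ => ENNReal.ofReal ((√A.toReal +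
      ‖f - mulL ν (cutoffGaussianLp ν x₀ n 0) f‖) ^ 2)) atTop (𝓝 A) := by
    have h3 := ((tendsto_norm_sub_mulL_cutoff x₀ f).const_add (√A.toReal)).pow 2
    rw [add_zero, Real.sq_sqrt ENNReal.toReal_nonneg] at h3
    have h4 := ENNReal.tendsto_ofReal h3
    rwa [ENNReal.ofReal_toReal hAtop] at h4
  calc ∫⁻ x, ENNReal.ofReal (Real.exp (2 * -c₂ * ‖x - x₀‖ ^ 2)) * ‖S f x‖ₑ ^ 2 ∂ν
      = ∫⁻ x, liminf (fun n : ℕ =>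
          ‖cutoffGaussian x₀ n ((-c₂ : ℝ) : ℂ) x‖ₑ ^ 2 * ‖S f x‖ₑ ^ 2) atTop ∂ν := by
        refine lintegral_congr fun x => ?_
        refine (Tendsto.liminf_eq (tendsto_const_nhds.congr' ?_)).symm
        filter_upwards [eventually_mem_ball_natCast x₀ x] with n hn
        rw [enorm_cutoffGaussian_sq_eq hn]
    _ ≤ liminf (fun n : ℕ => ∫⁻ x,
          ‖cutoffGaussian x₀ n ((-c₂ : ℝ) : ℂ) x‖ₑ ^ 2 * ‖S f x‖ₑ ^ 2 ∂ν) atTop := by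
        refine lintegral_liminf_le' fun n => ?_
        have hm1 : AEMeasurable (fun x => ‖cutoffGaussian x₀ n ((-c₂ : ℝ) : ℂ) x‖ₑ ^ 2) ν :=
          ((measurable_cutoffGaussian x₀ n _).enorm.pow_const 2).aemeasurable
        have hm2 : AEMeasurable (fun x => ‖S f x‖ₑ ^ 2) ν :=
          (Lp.aestronglyMeasurable _).enorm.pow_const 2
        exact hm1.mul hm2
    _ ≤ liminf (fun n : ℕ => ENNReal.ofReal ((√A.toReal +
          ‖f - mulL ν (cutoffGaussianLp ν x₀ n 0) f‖) ^ 2)) atTop := by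
        refine liminf_le_liminf (Eventually.of_forall fun n => ?_)
        rw [← hsq]
        exact ENNReal.ofReal_le_ofReal (pow_le_pow_left₀ (norm_nonneg _) (h2 n) 2)
    _ = A := hlim.liminf_eq

end RemovingCutoff

/-! ### The numerical constant -/

section Numeric

/-- The precision matters: with 1.756 in place of 1.7551, the quadratic inequality ending
`exists_time_fraction` would fail. -/
lemma exp_nine_sixteenths_le : Real.exp (9 / 16) ≤ 1.7551 := by
  have h := Real.exp_bound' (x := 9 / 16) (by norm_num) (by norm_num) (n := 7) (by norm_num)
  refine h.trans ?_
  norm_num [Finset.sum_range_succ, Nat.factorial]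

/-- The optimisation that produces the constant `5.56`. -/
lemma exists_time_fraction {r : ℝ} (hr : 0 ≤ r) :
    ∃ θ : ℝ, 0 < θ ∧ θ ≤ 1 ∧
      Real.exp (4 * r * θ) * ((1 + √(1 / θ)) ^ 2 / 4) ≤ 1 + 5.56 * r := by
  have hA := exp_nine_sixteenths_le
  -- For small r take θ = 1 and bound e^{4r} by its chord over 0 ≤ 4r ≤ 9/16. For larger r choose θ
  -- so that 4rθ stays equal to 9/16; the two choices meet at r = 9/64.
  rcases le_total r (9 / 64) with h | h
  · refine ⟨1, one_pos, le_rfl, ?_⟩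
    have hconv := convexOn_exp.2
    have h1 := hconv (Set.mem_univ 0) (Set.mem_univ (9 / 16))
      (show 0 ≤ 1 - 64 / 9 * r by linarith) (show 0 ≤ 64 / 9 * r by positivity) (by ring)
    simp only [smul_eq_mul, mul_zero, zero_add, Real.exp_zero, mul_one] at h1
    have e : 64 / 9 * r * (9 / 16) = 4 * r * 1 := by ring
    rw [e] at h1
    rw [div_one, Real.sqrt_one]
    have h2 : 64 / 9 * r * Real.exp (9 / 16) ≤ 64 / 9 * r * 1.7551 := by gcongr
    norm_num at h1 h2 ⊢
    linarith
  · have hr0 : 0 < r := by linarith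
    refine ⟨9 / (64 * r), by positivity, ?_, ?_⟩
    · rw [div_le_one (by positivity)]; linarith
    · have e1 : 4 * r * (9 / (64 * r)) = 9 / 16 := by field_simp; norm_num
      have e2 : √(1 / (9 / (64 * r))) = 8 / 3 * √r := by
        have : 1 / (9 / (64 * r)) = (8 / 3) ^ 2 * r := by field_simp; norm_num
        rw [this, Real.sqrt_mul (by positivity), Real.sqrt_sq (by positivity)]
      rw [e1, e2]
      have hq := Real.sq_sqrt hr
      set q := √r
      calc _ ≤ 1.7551 * ((1 + 8 / 3 * q) ^ 2 / 4) := by gcongr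
        _ ≤ 1 + 5.56 * r := by
            rw [← hq]
            -- The difference of the two sides is a quadratic in q = √r with barely negative
            -- discriminant and minimum near 0.48.
            nlinarith [sq_nonneg (q - 0.48)]

end Numeric

/-! ### Weighted L₂ estimates for the semigroup -/

section Main

variable {d : ℕ} {Ω : Set (EuclideanSpace ℝ (Fin d))}
variable {T : ℝ → L2 Ω →L[ℂ] L2 Ω} {M ω a E : ℝ}

/-- Weighted estimate for bounded functions. -/
lemma lintegral_weighted_le_of_norm_le_one (ha : 0 < a) {s τ : ℝ} (hτ : 0 < τ) (hs : 0 ≤ s)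
    (x₀ : EuclideanSpace ℝ (Fin d)) {f : L2 Ω}
    (hf : eLpNorm f ∞ (volume.restrict Ω) ≤ 1) :
    ∫⁻ x in Ω, ENNReal.ofReal (Real.exp (2 * -(1 / (a * (s + τ))) * ‖x - x₀‖ ^ 2)) * ‖f x‖ₑ ^ 2 ≤
      ENNReal.ofReal ((Real.pi * a * (s + τ) / 2) ^ ((d : ℝ) / 2)) := by
  have hσ : 0 < s + τ := by linarith
  have hae : ∀ᵐ x ∂(volume.restrict Ω), ‖f x‖ₑ ≤ 1 := by
    rw [eLpNorm_exponent_top] at hf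
    filter_upwards [ae_le_eLpNormEssSup (f := f) (μ := volume.restrict Ω)] with x hx
    exact hx.trans hf
  have hb : 0 < 2 * (1 / (a * (s + τ))) := by positivity
  calc _ ≤ ∫⁻ x in Ω, ENNReal.ofReal (Real.exp (-(2 * (1 / (a * (s + τ)))) * ‖x - x₀‖ ^ 2)) := by
        refine lintegral_mono_ae ?_
        filter_upwards [hae] with x hx
        rw [mul_neg]
        exact mul_le_of_le_one_right' (pow_le_one' hx 2)
    _ ≤ ∫⁻ x, ENNReal.ofReal (Real.exp (-(2 * (1 / (a * (s + τ)))) * ‖x - x₀‖ ^ 2)) :=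
        lintegral_mono' Measure.restrict_le_self le_rfl
    _ = _ := by
        rw [lintegral_gaussian hb]
        congr 2
        field_simp

/-- Weighted `L₂`-estimate for the semigroup. -/
lemma lintegral_weighted_semigroup_le (hG : HasGaussianUpperBounds T M ω a) (h0 : T 0 = .id ℂ _)
    {S : ℂ → L2 Ω →L[ℂ] L2 Ω} (hSd : DifferentiableOn ℂ S {z | 0 < z.re})
    (hSn : ∀ z : ℂ, 0 < z.re → ‖S z‖ ≤ 1)
    (hST : ∀ t : ℝ, 0 < t → S t = ((Real.exp (E * t) : ℝ) : ℂ) • T t) {s τ : ℝ}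
    (hs : 0 ≤ s) (hτ : 0 < τ) (x₀ : EuclideanSpace ℝ (Fin d)) (f : L2 Ω) :
    ∫⁻ x in Ω, ENNReal.ofReal (Real.exp (2 * -(1 / (a * τ)) * ‖x - x₀‖ ^ 2)) * ‖T s f x‖ₑ ^ 2 ≤
      ENNReal.ofReal (Real.exp (-(2 * E * s))) *
        ∫⁻ x in Ω, ENNReal.ofReal (Real.exp (2 * -(1 / (a * (s + τ))) * ‖x - x₀‖ ^ 2)) *
          ‖f x‖ₑ ^ 2 := by
  have ha := hG.pos
  rcases hs.eq_or_lt with h | hs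
  · subst h
    simp [h0]
  have hl : 0 < τ / s := by positivity
  have e1 : a * s * (τ / s) = a * τ := by field_simp
  have e2 : a * s * (1 + τ / s) = a * (s + τ) := by field_simp
  have hcut : ∀ (R : ℝ) (u : L2 Ω), ‖mulL _ (cutoffGaussianLp _ x₀ R ((-(1 / (a * τ)) : ℝ) : ℂ))
      (S s (mulL _ (cutoffGaussianLp _ x₀ R ((1 / (a * (s + τ)) : ℝ) : ℂ)) u))‖ ≤ ‖u‖ := by
    intro R u
    have h := norm_weighted_inner_le_of_holomorphic hG hSd hSn hST hs hl x₀ R u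
    rw [e1, e2] at h
    generalize mulL _ (cutoffGaussianLp _ x₀ R ((-(1 / (a * τ)) : ℝ) : ℂ))
      (S s (mulL _ (cutoffGaussianLp _ x₀ R ((1 / (a * (s + τ)) : ℝ) : ℂ)) u)) = w at h ⊢
    have h2 := h w
    rw [inner_self_eq_norm_sq_to_K, norm_pow] at h2
    have h3 : ‖((‖w‖ : ℝ) : ℂ)‖ = ‖w‖ := by simp
    have h4 : ‖w‖ ^ 2 ≤ ‖w‖ * ‖u‖ := by
      refine le_trans (le_of_eq ?_) h2
      exact congrArg (· ^ 2) h3.symm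
    rcases (norm_nonneg w).eq_or_lt with h5 | h5
    · rw [← h5]; exact norm_nonneg u
    · rw [pow_two] at h4
      exact le_of_mul_le_mul_left h4 h5
  have key := lintegral_weighted_le_of_cutoff (hSn s (by simpa using hs))
    (by positivity : 0 ≤ 1 / (a * (s + τ))) (by positivity : 0 ≤ 1 / (a * τ)) x₀ hcut f
  have hTS : T s f = ((Real.exp (-(E * s)) : ℝ) : ℂ) • S s f := by
    rw [hST s hs, smul_apply, smul_smul, ← Complex.ofReal_mul, ← Real.exp_add, neg_add_cancel,
      Real.exp_zero, Complex.ofReal_one, one_smul]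
  refine le_trans (le_of_eq ?_) (mul_le_mul_right key (ENNReal.ofReal (Real.exp (-(2 * E * s)))))
  rw [← lintegral_const_mul' _ _ ENNReal.ofReal_ne_top]
  refine lintegral_congr_ae ?_
  have hcoe : T s f =ᵐ[volume.restrict Ω] fun x => ((Real.exp (-(E * s)) : ℝ) : ℂ) * S s f x := by
    rw [hTS]
    exact Lp.coeFn_smul _ _
  filter_upwards [hcoe] with x hx
  have hn : ‖((Real.exp (-(E * s)) : ℝ) : ℂ)‖ₑ ^ 2 = ENNReal.ofReal (Real.exp (-(2 * E * s))) := by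
    rw [← ofReal_norm, Complex.norm_of_nonneg (Real.exp_pos _).le,
      ← ENNReal.ofReal_pow (Real.exp_pos _).le, ← Real.exp_nat_mul]
    congr 2
    push_cast
    ring
  rw [hx, enorm_mul, mul_pow, hn]
  ring

end Main

end GaussianSemigroup

namespace GaussianSemigroup

/-! ### From weighted L₂ to L_∞, and the final constant -/

section Main

variable {d : ℕ} {Ω : Set (EuclideanSpace ℝ (Fin d))}
variable {T : ℝ → L2 Ω →L[ℂ] L2 Ω} {M ω a E : ℝ}

/-- Pointwise estimate for an operator with Gaussian kernel bound, in terms of weighted `L₂`-bounds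
of the function it is applied to. -/
lemma enorm_le_of_lintegral_weighted_le {x₀ : EuclideanSpace ℝ (Fin d)} {B g : L2 Ω}
    {q : EuclideanSpace ℝ (Fin d) → ℂ} {c s τ K a : ℝ} (ha : 0 < a) (hs : 0 < s) (hτ : s < τ)
    (hc : 0 ≤ c) (hK : 0 ≤ K)
    (hB : B x₀ = ∫ y in Ω, q y * g y)
    (hq : ∀ᵐ y ∂(volume.restrict Ω), ‖q y‖ ≤ c * Real.exp (-(‖x₀ - y‖ ^ 2 / (a * s))))
    (hg : ∫⁻ y in Ω, ENNReal.ofReal (Real.exp (2 * -(1 / (a * τ)) * ‖y - x₀‖ ^ 2)) * ‖g y‖ₑ ^ 2 ≤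
      ENNReal.ofReal K) :
    ‖B x₀‖ₑ ≤ ENNReal.ofReal
      (c * (((Real.pi * a * s * τ / (2 * (τ - s))) ^ ((d : ℝ) / 2)) ^ (1 / 2 : ℝ) * K ^ (1 / 2 : ℝ))) := by
  have hτ0 : 0 < τ := hs.trans hτ
  have hτs : 0 < τ - s := sub_pos.2 hτ
  -- The kernel's Gaussian is split into the weight carried by g and a remainder with exponent k; s
  -- < τ makes the remainder square integrable.
  set k : ℝ := 1 / (a * s) - 1 / (a * τ) with hk
  have hk0 : k = (τ - s) / (a * s * τ) := by rw [hk]; field_simp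
  have hkpos : 0 < k := by rw [hk0]; positivity
  set U : EuclideanSpace ℝ (Fin d) → ℝ≥0∞ := fun y => ENNReal.ofReal (Real.exp (-k * ‖y - x₀‖ ^ 2))
    with hU
  set V : EuclideanSpace ℝ (Fin d) → ℝ≥0∞ := fun y =>
    ENNReal.ofReal (Real.exp (-(1 / (a * τ)) * ‖y - x₀‖ ^ 2)) * ‖g y‖ₑ with hV
  have hUm : Measurable U := by
    refine ENNReal.measurable_ofReal.comp (Continuous.measurable ?_)
    fun_prop
  have hVm : AEMeasurable V (volume.restrict Ω) := by
    refine AEMeasurable.mul (Measurable.aemeasurable ?_) (Lp.aestronglyMeasurable g).enorm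
    refine ENNReal.measurable_ofReal.comp (Continuous.measurable ?_)
    fun_prop
  have hU2 : ∫⁻ y in Ω, U y ^ (2 : ℝ) ≤
      ENNReal.ofReal ((Real.pi * a * s * τ / (2 * (τ - s))) ^ ((d : ℝ) / 2)) := by
    calc _ ≤ ∫⁻ y, ENNReal.ofReal (Real.exp (-(2 * k) * ‖y - x₀‖ ^ 2)) := by
          refine lintegral_mono' Measure.restrict_le_self fun y => ?_
          simp only [hU]
          rw [ENNReal.ofReal_rpow_of_pos (Real.exp_pos _), ← Real.exp_mul]
          refine le_of_eq ?_
          congr 2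
          ring
      _ = _ := by
          rw [lintegral_gaussian (by positivity), hk0]
          congr 2
          field_simp
  have hV2 : ∫⁻ y in Ω, V y ^ (2 : ℝ) ≤ ENNReal.ofReal K := by
    refine le_trans (le_of_eq (lintegral_congr fun y => ?_)) hg
    simp only [hV]
    rw [ENNReal.mul_rpow_of_nonneg _ _ zero_le_two, ENNReal.ofReal_rpow_of_pos (Real.exp_pos _),
      ← Real.exp_mul, ENNReal.rpow_two]
    congr 3
    ring
  have hCS := ENNReal.lintegral_mul_le_Lp_mul_Lq (volume.restrict Ω) Real.HolderConjugate.two_two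
    hUm.aemeasurable hVm
  calc ‖B x₀‖ₑ ≤ ∫⁻ y in Ω, ‖q y * g y‖ₑ := by
        rw [hB]; exact enorm_integral_le_lintegral_enorm _
    _ ≤ ∫⁻ y in Ω, ENNReal.ofReal c * (U * V) y := by
        refine lintegral_mono_ae ?_
        filter_upwards [hq] with y hy
        have h1 : ‖q y‖ₑ ≤ ENNReal.ofReal c * (ENNReal.ofReal (Real.exp (-k * ‖y - x₀‖ ^ 2)) *
            ENNReal.ofReal (Real.exp (-(1 / (a * τ)) * ‖y - x₀‖ ^ 2))) := by
          rw [← ofReal_norm, ← ENNReal.ofReal_mul (Real.exp_pos _).le, ← ENNReal.ofReal_mul hc,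
            ← Real.exp_add]
          refine ENNReal.ofReal_le_ofReal (hy.trans (le_of_eq ?_))
          rw [norm_sub_rev, hk]
          congr 2
          ring
        rw [enorm_mul, Pi.mul_apply]
        calc _ ≤ ENNReal.ofReal c * (ENNReal.ofReal (Real.exp (-k * ‖y - x₀‖ ^ 2)) *
            ENNReal.ofReal (Real.exp (-(1 / (a * τ)) * ‖y - x₀‖ ^ 2))) * ‖g y‖ₑ := by gcongr
          _ = _ := by simp only [hU, hV]; ring
    _ = ENNReal.ofReal c * ∫⁻ y in Ω, (U * V) y := lintegral_const_mul' _ _ ENNReal.ofReal_ne_top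
    _ ≤ ENNReal.ofReal c * ((∫⁻ y in Ω, U y ^ (2 : ℝ)) ^ (1 / 2 : ℝ) *
          (∫⁻ y in Ω, V y ^ (2 : ℝ)) ^ (1 / 2 : ℝ)) := by gcongr
    _ ≤ ENNReal.ofReal c *
          (ENNReal.ofReal ((Real.pi * a * s * τ / (2 * (τ - s))) ^ ((d : ℝ) / 2)) ^ (1 / 2 : ℝ) *
          ENNReal.ofReal K ^ (1 / 2 : ℝ)) := by gcongr
    _ = _ := by
        rw [ENNReal.ofReal_rpow_of_nonneg (by positivity) (by norm_num),
          ENNReal.ofReal_rpow_of_nonneg hK (by norm_num), ← ENNReal.ofReal_mul (by positivity),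
          ← ENNReal.ofReal_mul hc]

lemma gaussian_constant_eq {a s x δ e : ℝ} (ha : 0 < a) (hs : 0 < s) (hx : 0 < x) :
    (a * Real.pi * s) ^ (-δ) *
      (((Real.pi * a * s * (s * (1 + x)) / (2 * (s * (1 + x) - s))) ^ δ) ^ (1 / 2 : ℝ) *
        (Real.exp (-(2 * e)) * (Real.pi * a * (s * x ^ 2 - s + s * (1 + x)) / 2) ^ δ) ^ (1 / 2 : ℝ))
      = Real.exp (-e) * ((1 + x) ^ 2 / 4) ^ (δ / 2) := by
  have hπ := Real.pi_pos
  have e1 : Real.pi * a * s * (s * (1 + x)) / (2 * (s * (1 + x) - s)) =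
      a * Real.pi * s * ((1 + x) / (2 * x)) := by
    have : s * (1 + x) - s = s * x := by ring
    rw [this]; field_simp
  have e2 : Real.pi * a * (s * x ^ 2 - s + s * (1 + x)) / 2 =
      a * Real.pi * s * (x * (1 + x) / 2) := by ring
  have e3 : Real.exp (-(2 * e)) ^ (1 / 2 : ℝ) = Real.exp (-e) := by
    rw [← Real.exp_mul]; congr 1; ring
  rw [e1, e2, Real.mul_rpow (Real.exp_pos _).le (by positivity), e3, ← Real.rpow_mul (by positivity),
    ← Real.rpow_mul (by positivity)]
  have hQ : 0 < a * Real.pi * s := by positivity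
  generalize a * Real.pi * s = Q at hQ
  have e4 : δ * (1 / 2) = δ / 2 := by ring
  rw [e4, Real.mul_rpow hQ.le (by positivity), Real.mul_rpow hQ.le (by positivity)]
  have e5 : Q ^ (-δ) * (Q ^ (δ / 2) * Q ^ (δ / 2)) = 1 := by
    rw [← Real.rpow_add hQ, ← Real.rpow_add hQ]
    have : -δ + (δ / 2 + δ / 2) = 0 := by ring
    rw [this, Real.rpow_zero]
  have e6 : ((1 + x) / (2 * x)) ^ (δ / 2) * (x * (1 + x) / 2) ^ (δ / 2) =
      ((1 + x) ^ 2 / 4) ^ (δ / 2) := by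
    rw [← Real.mul_rpow (by positivity) (by positivity)]
    congr 1
    field_simp
    norm_num
  rw [← e6]
  linear_combination (Real.exp (-e) * ((1 + x) / (2 * x)) ^ (δ / 2) *
    (x * (1 + x) / 2) ^ (δ / 2)) * e5

/-- The `L_∞`-bound obtained by using the kernel for the time `s` and the weighted `L₂`-bound for the
remaining time. -/
lemma normPQ_top_le (hG : HasGaussianUpperBounds T M ω a) (hT : IsC0Semigroup T)
    {S : ℂ → L2 Ω →L[ℂ] L2 Ω} (hSd : DifferentiableOn ℂ S {z | 0 < z.re})
    (hSn : ∀ z : ℂ, 0 < z.re → ‖S z‖ ≤ 1)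
    (hST : ∀ t : ℝ, 0 < t → S t = ((Real.exp (E * t) : ℝ) : ℂ) • T t) {s t : ℝ}
    (hs : 0 < s) (hst : s ≤ t) :
    normPQ (T t) ∞ ∞ ≤ ENNReal.ofReal (M * Real.exp (ω * s) *
      (Real.exp (-(E * (t - s))) * ((1 + √(t / s)) ^ 2 / 4) ^ ((d : ℝ) / 4))) := by
  have ha := hG.pos
  have hM : 0 < M := one_pos.trans_le hG.one_le
  have ht : 0 < t := hs.trans_le hst
  refine iSup₂_le fun f hf => ?_
  obtain ⟨p, hp, hpb⟩ := hG.exists_kernel s hs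
  have hpb' : ∀ᵐ x ∂(volume.restrict Ω), ∀ᵐ y ∂(volume.restrict Ω), ‖p x y‖ ≤
      M * Real.exp (ω * s) * (a * Real.pi * s) ^ (-((d : ℝ) / 2)) *
        Real.exp (-(‖x - y‖ ^ 2 / (a * s))) := Measure.ae_ae_of_ae_prod hpb
  have hTf : T t f = T s (T (t - s) f) := by
    rw [← hT.apply_add hs.le (by linarith), add_sub_cancel]
  set x : ℝ := √(t / s) with hx
  have hx0 : 0 < x := Real.sqrt_pos.2 (by positivity)
  have hx2 : s * x ^ 2 = t := by
    rw [hx, Real.sq_sqrt (by positivity)]; field_simp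
  rw [eLpNorm_exponent_top]
  refine eLpNormEssSup_le_of_ae_enorm_bound ?_
  filter_upwards [hp.apply_eq (T (t - s) f), hpb'] with x₀ h1 h2
  -- The choice τ = s(1+x) = s + √(st) minimises τ(t - s + τ)/(τ - s), the product of the two
  -- Gaussian integrals up to constants; the minimum is (√s + √t)².
  have hτ : s < s * (1 + x) := by nlinarith
  have hg := (lintegral_weighted_semigroup_le hG hT.map_zero hSd hSn hST (sub_nonneg.2 hst)
    (hs.trans hτ) x₀ f).trans (mul_le_mul_right (lintegral_weighted_le_of_norm_le_one ha
      (hs.trans hτ) (sub_nonneg.2 hst) x₀ hf) _)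
  rw [← ENNReal.ofReal_mul (Real.exp_pos _).le] at hg
  rw [hTf]
  have hts : 0 ≤ t - s := sub_nonneg.2 hst
  have hσ : 0 < t - s + s * (1 + x) := by linarith
  refine (enorm_le_of_lintegral_weighted_le ha hs hτ (by positivity) (by positivity) h1 h2
    hg).trans (le_of_eq ?_)
  congr 1
  have key := gaussian_constant_eq (a := a) (s := s) (x := x) (δ := (d : ℝ) / 2)
    (e := E * (t - s)) ha hs hx0
  rw [hx2] at key
  have e4 : (d : ℝ) / 2 / 2 = (d : ℝ) / 4 := by ring
  rw [e4] at key
  rw [← key, mul_assoc 2 E, mul_assoc (M * Real.exp (ω * s))]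

/-- Since ωθt - E(t - θt) = -Et + 4δrθ, the excess e^{(E+ω)θt} is the δ-th power of e^{4rθ} and can
be merged with the geometric factor. -/
lemma bound_le_bound {M E ω r δ t θ : ℝ} (hM : 0 < M) (hδ : 0 < δ)
    (hr : 4 * δ * r = (E + ω) * t) (hr0 : 0 ≤ r)
    (h : Real.exp (4 * r * θ) * ((1 + √(1 / θ)) ^ 2 / 4) ≤ 1 + 5.56 * r) :
    M * Real.exp (ω * (θ * t)) *
        (Real.exp (-(E * (t - θ * t))) * ((1 + √(1 / θ)) ^ 2 / 4) ^ δ) ≤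
      (2 : ℝ) ^ (1 / 4 : ℝ) * M * (1 + 5.56 * r) ^ δ * Real.exp (-(E * t)) := by
  have e1 : Real.exp (ω * (θ * t)) * Real.exp (-(E * (t - θ * t))) =
      Real.exp (-(E * t)) * Real.exp (4 * r * θ) ^ δ := by
    rw [← Real.exp_mul, ← Real.exp_add, ← Real.exp_add]
    congr 1
    linear_combination (-θ) * hr
  calc _ = M * Real.exp (-(E * t)) * (Real.exp (4 * r * θ) ^ δ * ((1 + √(1 / θ)) ^ 2 / 4) ^ δ) := by
        linear_combination (M * ((1 + √(1 / θ)) ^ 2 / 4) ^ δ) * e1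
    _ = M * Real.exp (-(E * t)) * (Real.exp (4 * r * θ) * ((1 + √(1 / θ)) ^ 2 / 4)) ^ δ := by
        rw [Real.mul_rpow (Real.exp_pos _).le (by positivity)]
    _ ≤ M * Real.exp (-(E * t)) * (1 + 5.56 * r) ^ δ := by gcongr
    _ ≤ (2 : ℝ) ^ (1 / 4 : ℝ) * (M * Real.exp (-(E * t)) * (1 + 5.56 * r) ^ δ) := by
        refine le_mul_of_one_le_left (by positivity) ?_
        exact Real.one_le_rpow one_le_two (by norm_num)
    _ = _ := by ring

lemma HasGaussianUpperBounds.locally_bounded (hG : HasGaussianUpperBounds T M ω a)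
    (hT : IsC0Semigroup T) (b : ℝ) : ∃ C : ℝ, ∀ t ∈ Set.Icc 0 b, ‖T t‖ ≤ C := by
  have hM : 0 < M := one_pos.trans_le hG.one_le
  refine ⟨max 1 (2 * M * Real.exp (|ω| * |b|)), fun t ht => ?_⟩
  rcases ht.1.eq_or_lt with h | h
  · rw [← h, hT.map_zero]
    exact (ContinuousLinearMap.norm_id_le).trans (le_max_left _ _)
  · refine ((hG.norm_le h).trans ?_).trans (le_max_right _ _)
    gcongr
    · exact le_abs_self ω
    · exact ht.2.trans (le_abs_self b)

/-- The rescaled semigroup `e^{-t(H - E)}` of a selfadjoint operator `H ≥ E` extends holomorphically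
and contractively to the right half-plane. -/
lemma exists_rescaled_extension {X : Type*} [NormedAddCommGroup X] [InnerProductSpace ℂ X]
    [CompleteSpace X] {T : ℝ → X →L[ℂ] X} {E : ℝ} (hT : IsC0Semigroup T)
    (hsa : ∀ t, 0 ≤ t → IsSelfAdjoint (T t)) (hn : ∀ t, 0 ≤ t → ‖T t‖ ≤ Real.exp (-(E * t))) :
    ∃ S : ℂ → X →L[ℂ] X, DifferentiableOn ℂ S {z | 0 < z.re} ∧ (∀ z : ℂ, 0 < z.re → ‖S z‖ ≤ 1) ∧
      ∀ t : ℝ, 0 < t → S t = ((Real.exp (E * t) : ℝ) : ℂ) • T t := by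
  refine exists_holomorphic_extension (B := fun t => ((Real.exp (E * t) : ℝ) : ℂ) • T t) ?_ ?_ ?_
  · refine ⟨by simp [hT.map_zero], fun s t hs ht => ?_, fun f => ?_⟩
    · ext f
      simp only [smul_apply, ContinuousLinearMap.comp_apply, map_smul]
      rw [hT.apply_add hs ht, smul_smul, mul_add, Real.exp_add, Complex.ofReal_mul,
        mul_comm ((Real.exp (E * s) : ℝ) : ℂ)]
    · have h1 : Tendsto (fun t : ℝ => ((Real.exp (E * t) : ℝ) : ℂ)) (𝓝[>] 0) (𝓝 1) := by
        have hc : Continuous fun t : ℝ => ((Real.exp (E * t) : ℝ) : ℂ) := by fun_prop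
        have := hc.tendsto 0
        simp only [mul_zero, Real.exp_zero, Complex.ofReal_one] at this
        exact this.mono_left nhdsWithin_le_nhds
      have h2 := h1.smul (hT.tendsto_zero f)
      rw [one_smul] at h2
      exact h2
  · intro t ht
    exact IsSelfAdjoint.smul (Complex.conj_ofReal _) (hsa t ht)
  · intro t ht
    rw [norm_smul, Complex.norm_of_nonneg (Real.exp_pos _).le]
    calc _ ≤ Real.exp (E * t) * Real.exp (-(E * t)) := by gcongr; exact hn t ht
      _ = 1 := by rw [← Real.exp_add, add_neg_cancel, Real.exp_zero]

end Main

end GaussianSemigroup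

theorem theorem1p1 {d : ℕ} (hd : 0 < d)
    (Ω : Set (EuclideanSpace ℝ (Fin d))) (hΩ : NullMeasurableSet Ω volume)
    (H : GaussianSemigroup.L2 Ω →ₗ.[ℂ] GaussianSemigroup.L2 Ω)
    (hH : IsSelfAdjoint H)
    (E₀ : ℝ) (hE₀ : IsGLB {x : ℝ | (x : ℂ) ∈ GaussianSemigroup.spectrum H} E₀)
    (T : ℝ → GaussianSemigroup.L2 Ω →L[ℂ] GaussianSemigroup.L2 Ω)
    (hT : GaussianSemigroup.IsSemigroupGeneratedByNeg H T)
    (M ω a : ℝ) (hG : GaussianSemigroup.HasGaussianUpperBounds T M ω a)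
    (t : ℝ) (ht : 0 ≤ t) :
    GaussianSemigroup.normPQ (T t) ∞ ∞ ≤
      ENNReal.ofReal ((2 : ℝ) ^ (1 / 4 : ℝ) * M *
        (1 + 5.56 / (d : ℝ) * (E₀ + ω) * t) ^ ((d : ℝ) / 4) * Real.exp (-(E₀ * t))) := by
  have hM : 0 < M := one_pos.trans_le hG.one_le
  have hd' : (0 : ℝ) < d := by exact_mod_cast hd
  have hC := hT.isC0Semigroup
  -- At t = 0 there is no kernel; the claim reduces to 1 ≤ 2^{1/4}M.
  rcases ht.eq_or_lt with h | ht
  · subst h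
    refine iSup₂_le fun f hf => ?_
    rw [hC.map_zero]
    refine hf.trans ?_
    rw [mul_zero, mul_zero, add_zero, Real.one_rpow, mul_one, neg_zero, Real.exp_zero, mul_one,
      ENNReal.one_le_ofReal]
    exact one_le_mul_of_one_le_of_one_le (Real.one_le_rpow one_le_two (by norm_num)) hG.one_le
  have hb := hG.locally_bounded hC
  have hres : ∀ μ : ℝ, μ < E₀ → (μ : ℂ) ∈ GaussianSemigroup.resolventSet H := by
    intro μ hμ
    by_contra h
    exact absurd (hE₀.1 h) (not_le.2 hμ)
  have hlow := GaussianSemigroup.lower_bound_of_resolventSet hH hres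
  have hsa : ∀ t, 0 ≤ t → IsSelfAdjoint (T t) := fun t ht => hT.isSelfAdjoint hH hb ht
  have hn : ∀ t, 0 ≤ t → ‖T t‖ ≤ Real.exp (-(E₀ * t)) := fun t ht => hT.norm_le hH hb hlow ht
  have hω : ∀ t, 0 < t → ‖T t‖ ≤ Real.exp (ω * t) := fun t ht =>
    hC.norm_le_exp hsa (by positivity : 0 < 2 * M) (fun t ht => hG.norm_le ht) ht
  -- The bound ‖T(t)‖ ≤ e^{ωt} forces H ≥ -ω, so no real point below -ω is spectral. This makes r
  -- nonnegative, as the choice of θ requires.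
  have hEω : 0 ≤ E₀ + ω := by
    have : -ω ≤ E₀ := by
      refine hE₀.2 fun x hx => ?_
      by_contra! hlt
      refine hx ?_
      obtain ⟨μ, hμ⟩ := exists_lt (min x E₀)
      exact GaussianSemigroup.mem_resolventSet_of_lower_bound (hT.lower_bound hω) hlt
        (hμ.trans_le (min_le_left _ _)) (hres μ (hμ.trans_le (min_le_right _ _)))
    linarith
  obtain ⟨S, hSd, hSn, hST⟩ := GaussianSemigroup.exists_rescaled_extension hC hsa hn
  have hr : 0 ≤ (E₀ + ω) * t / d := by positivity
  obtain ⟨θ, hθ0, hθ1, hθ⟩ := GaussianSemigroup.exists_time_fraction hr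
  refine (GaussianSemigroup.normPQ_top_le hG hC hSd hSn hST (s := θ * t) (by positivity)
    (mul_le_of_le_one_left ht.le hθ1)).trans (ENNReal.ofReal_le_ofReal ?_)
  have e1 : t / (θ * t) = 1 / θ := by field_simp
  have e2 : 5.56 / (d : ℝ) * (E₀ + ω) * t = 5.56 * ((E₀ + ω) * t / d) := by ring
  rw [e1, e2]
  exact GaussianSemigroup.bound_le_bound hM (by positivity) (by field_simp) hr hθ
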